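/- Let $X$ and $S$ be complex manifolds, $\pi\colon X\to S$ a smooth morphism (holomorphic submersion), $T_{X|S}=\ker(d\pi\colon T_X\to\pi^*T_S)$ the relative tangent sheaf, and $\pi^{-1}T_S\subset\pi^*T_S$ the subsheaf of *basic vector fields*, i.e. of sections locally of the form $x\mapsto Z(\pi(x))$ with $Z$ a holomorphic vector field on an open subset of $S$. A *Lie algebroid* on $X$ is a reflexive (coherent) sheaf $\mathcal A$ of $\mathcal O_X$-modules with an $\mathcal O_X$-linear anchor $a\colon\mathcal A\to T_X$ and a $\mathbb C$-bilinear bracket $\{\cdot,\cdot\}$ on $\mathcal A$ which is skew-symmetric, satisfies the Jacobi identity, and satisfies $\{gu,v\}=g\{u,v\}-a(v)(g)\,u$ for $g\in\mathcal O_X$. A *family of Lie algebroids* over $\pi$ is a reflexive sheaf $\mathcal A_S$ of $\mathcal O_X$-modules, flat over $S$, with an $\mathcal O_X$-linear anchor $a_S\colon\mathcal A_S\to T_{X|S}$ and a $\pi^{-1}\mathcal O_S$-bilinear bracket $\{\cdot,\cdot\}_S$ with the same three properties. An *unfolding* of $\mathcal A_S$ is a Lie algebroid $(\mathcal A,a,\{\cdot,\cdot\})$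 on $X$ containing $\mathcal A_S$, with its anchor and bracket, as $\mathcal A_S=a^{-1}(\mathrm{Im}\,a_S)$, and such that $\mathrm{rank}\,\mathcal A=\mathrm{rank}\,\mathcal A_S+\dim S$. It is *transversal* if the map $\mathrm{Coker}(a_S)\to\mathrm{Coker}(a)$ induced by $\mathcal A_S\subset\mathcal A$ and $T_{X|S}\subset T_X$ is an isomorphism. Let $\mathcal D(\mathcal A_S)=\mathrm{Der}_{\mathrm{Lie}}(\mathcal A_S)\cap D^{\le1}_X(\mathcal A_S)$ be the sheaf of pairs $(\psi,\sigma(\psi))$, where $\psi$ is a $\mathbb C$-linear endomorphism of the sheaf $\mathcal A_S$ which is a derivation of $\{\cdot,\cdot\}_S$, and its symbol $\sigma(\psi)$ is a holomorphic vector field on $X$ with $\psi(f\alpha)-f\psi(\alpha)=\sigma(\psi)(f)\,\alpha$ for all $f\in\mathcal O_X$, $\alpha\in\mathcal A_S$. The map $\alpha\mapsto(\{\alpha,-\}_S,a_S(\alpha))$ sends $\mathcal A_S$ to $\mathcal D(\mathcal A_S)$; let $\mathcal D(\mathcal A_S)/\mathcal A_S$ be its cokernel. The symbol induces $\sigma\colon\mathcal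 D(\mathcal A_S)/\mathcal A_S\to\pi^*T_S$, and one sets $\mathfrak u(\mathcal A_S)=\sigma^{-1}(\pi^{-1}T_S)\subseteq\mathcal D(\mathcal A_S)/\mathcal A_S$. **Proposition.** Let $\mathcal A$ be a transversal unfolding of $\mathcal A_S$. Then the map $[a]\colon\mathcal A/\mathcal A_S\to\pi^*T_S$ induced by the anchor is an isomorphism; let $\upsilon_{\mathcal A}$ be its inverse. If $s$ is a section of $\mathcal A$, over an open set $V\subseteq X$, whose class in $\mathcal A/\mathcal A_S$ lies in $\upsilon_{\mathcal A}(\pi^{-1}T_S)$, then $\{\mathcal A_S|_V,s\}\subseteq\mathcal A_S|_V$. Consequently $\upsilon_{\mathcal A}(\pi^{-1}T_S)$ is a subsheaf of $\mathfrak u(\mathcal A_S)$: there is an injective morphism of sheaves $j\colon\pi^{-1}T_S\to\mathfrak u(\mathcal A_S)$, with $\sigma\circ j=\mathrm{id}$, which sends $Z\in\pi^{-1}T_S(V)$ to the class of $(\{s,-\}|_{\mathcal A_S},a(s))\in\mathcal D(\mathcal A_S)(V)$ for every section $s\in\mathcal A(V)$ that lifts $\upsilon_{\mathcal A}(Z)$.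 -/

import Mathlib

open CategoryTheory CategoryTheory.Limits TopologicalSpace Opposite
open scoped Manifold ContDiff

universe u

namespace HolAlgebroid

noncomputable section

/-- The model space `ℂⁿ` of an `n`-dimensional complex manifold. -/
abbrev Cn (n : ℕ) : Type := EuclideanSpace ℂ (Fin n)

section StructureSheaf

variable (n : ℕ) (X : Type u) [TopologicalSpace X] [ChartedSpace (Cn n) X]

/-- Holomorphic functions on an open subset of a complex manifold, as a subring of all
functions. -/
def holSubring (U : Opens X) : Subring (U → ℂ) where
  carrier := {f | ContMDiff 𝓘(ℂ, Cn n) 𝓘(ℂ, ℂ) ω f}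
  mul_mem' hf hg := ContMDiff.mul hf hg
  one_mem' := contMDiff_const
  add_mem' hf hg := ContMDiff.add hf hg
  zero_mem' := contMDiff_const
  neg_mem' hf := ContMDiff.neg hf

/-- The ring `𝒪_X(U)` of holomorphic functions on an open subset of a complex manifold. -/
def Hol (U : Opens X) : Type u := holSubring n X U

instance (U : Opens X) : CommRing (Hol n X U) := inferInstanceAs (CommRing (holSubring n X U))

variable {X}

/-- Restriction of holomorphic functions. -/
def Hol.res {U V : Opens X} (h : V ≤ U) : Hol n X U →+* Hol n X V where
  toFun f := ⟨fun x => f.1 ⟨x.1, h x.2⟩,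
    ContMDiff.comp (I' := 𝓘(ℂ, Cn n)) (g := f.1) f.2 (contMDiff_inclusion h)⟩
  map_one' := rfl
  map_mul' _ _ := rfl
  map_zero' := rfl
  map_add' _ _ := rfl

/-- Being holomorphic is a local property. -/
lemma contMDiff_of_locally {E' H' N : Type*} [NormedAddCommGroup E'] [NormedSpace ℂ E']
    [TopologicalSpace H'] {I' : ModelWithCorners ℂ E' H'} [TopologicalSpace N]
    [ChartedSpace H' N] {U : Opens X} (f : U → N)
    (hf : ∀ x : U, ∃ (V : Opens X) (_ : x.1 ∈ V) (h : V ≤ U),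
      ContMDiff 𝓘(ℂ, Cn n) I' ω (fun y : V => f ⟨y.1, h y.2⟩)) :
    ContMDiff 𝓘(ℂ, Cn n) I' ω f := by
  intro x
  obtain ⟨V, hxV, h, hV⟩ := hf x
  have := (contDiffWithinAt_localInvariantProp (I := 𝓘(ℂ, Cn n)) (I' := I')
    ω).liftPropAt_iff_comp_inclusion h f ⟨x.1, hxV⟩
  exact this.2 (hV ⟨x.1, hxV⟩)

variable (X)

/-- Holomorphy, as a local predicate on functions. -/
def holPred : TopCat.LocalPredicate (X := TopCat.of X) (fun _ => ℂ) where
  pred {U} f := f ∈ holSubring n X U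
  res i f hf := (Hol.res n i.le ⟨f, hf⟩).2
  locality {U} f hf := by
    refine contMDiff_of_locally (X := X) n (U := U) f fun x => ?_
    obtain ⟨V, hx, i, hV⟩ := hf x
    exact ⟨V, hx, i.le, hV⟩

/-- The structure sheaf of a complex manifold: the sheaf of holomorphic functions. -/
def structureSheaf : TopCat.Sheaf CommRingCat.{u} (TopCat.of X) where
  obj :=
    { obj U := CommRingCat.of (Hol n X U.unop)
      map i := CommRingCat.ofHom (Hol.res n i.unop.le)
      map_id _ := rfl
      map_comp _ _ := rfl }
  property := by
    rw [CategoryTheory.Presheaf.isSheaf_iff_isSheaf_forget _ _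
      (CategoryTheory.forget CommRingCat)]
    exact TopCat.subpresheafToTypes.isSheaf (holPred n X)

/-- The structure sheaf as a sheaf of (not necessarily commutative) rings, over which Mathlib's
sheaves of modules are defined. -/
def ringSheaf : Sheaf (Opens.grothendieckTopology (TopCat.of X)) RingCat.{u} where
  obj := (structureSheaf n X).presheaf ⋙ forget₂ CommRingCat RingCat
  property := ((sheafCompose (Opens.grothendieckTopology (TopCat.of X))
    (forget₂ CommRingCat.{u} RingCat.{u})).obj (structureSheaf n X)).property

/-- Presheaves of `𝒪_X`-modules. -/
abbrev PMod : Type (u + 1) := PresheafOfModules.{u} (ringSheaf n X).obj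

/-- Sheaves of `𝒪_X`-modules. -/
abbrev OMod : Type (u + 1) := SheafOfModules.{u} (ringSheaf n X)


end StructureSheaf

section Sections

variable {n : ℕ} {X : Type u} [TopologicalSpace X] [ChartedSpace (Cn n) X]

/-- The sections of a presheaf of modules over an open set. -/
abbrev PSec (M : PMod n X) (U : Opens X) : Type u := M.presheaf.obj (op U)

instance (M : PMod n X) (U : Opens X) : Module (Hol n X U) (PSec M U) :=
  inferInstanceAs (Module ((ringSheaf n X).obj.obj (op U)) (M.obj (op U)))

/-- Restriction of sections of a presheaf of modules. -/
def pres (M : PMod n X) {U V : Opens X} (h : V ≤ U) : PSec M U →+ PSec M V :=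
  (M.presheaf.map (homOfLE h).op).hom

lemma pres_pres (M : PMod n X) {U V W : Opens X} (h : V ≤ U) (h' : W ≤ V) (s : PSec M U) :
    pres M h' (pres M h s) = pres M (h'.trans h) s :=
  (M.map_comp_apply (homOfLE h).op (homOfLE h').op s).symm

lemma pres_self (M : PMod n X) {U : Opens X} (h : U ≤ U) (s : PSec M U) : pres M h s = s :=
  congrArg (fun g => g.hom s) (M.presheaf.map_id (op U))

lemma pres_smul (M : PMod n X) {U V : Opens X} (h : V ≤ U) (f : Hol n X U) (s : PSec M U) :
    pres M h (f • s) = Hol.res n h f • pres M h s :=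
  M.map_smul (homOfLE h).op f s

/-- The sections of a sheaf of modules over an open set. -/
abbrev Sec (M : OMod n X) (U : Opens X) : Type u := PSec M.val U

/-- Restriction of sections of a sheaf of modules. -/
abbrev res (M : OMod n X) {U V : Opens X} (h : V ≤ U) : Sec M U →+ Sec M V := pres M.val h

/-- The action of a morphism of sheaves of modules on sections. -/
def onSec {M N : OMod n X} (φ : M ⟶ N) (U : Opens X) : Sec M U →ₗ[Hol n X U] Sec N U :=
  (φ.val.app (op U)).hom

lemma onSec_res {M N : OMod n X} (φ : M ⟶ N) {U V : Opens X} (h : V ≤ U) (s : Sec M U) :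
    onSec φ V (res M h s) = res N h (onSec φ U s) :=
  PresheafOfModules.naturality_apply φ.val (homOfLE h).op s

/-- The dual of a presheaf of `𝒪_X`-modules: its sections over `U` are the morphisms of
`𝒪_U`-modules `M|_U → 𝒪_U`, that is, compatible families of linear maps indexed by the open
subsets of `U`. -/
def dualSec (M : PMod n X) (U : Opens X) :
    AddSubgroup (∀ W : {W : Opens X // W ≤ U}, PSec M W.1 →ₗ[Hol n X W.1] Hol n X W.1) where
  carrier := {φ | ∀ (W W' : {W : Opens X // W ≤ U}) (h : W'.1 ≤ W.1) (s : PSec M W.1),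
    φ W' (pres M h s) = Hol.res n h (φ W s)}
  zero_mem' _ _ _ _ := rfl
  add_mem' {φ ψ} hφ hψ W W' h s := by
    have h1 := hφ W W' h s
    have h2 := hψ W W' h s
    simp only [Pi.add_apply, LinearMap.add_apply, map_add, h1, h2]
  neg_mem' {φ} hφ W W' h s := by
    have h1 := hφ W W' h s
    simp only [Pi.neg_apply, LinearMap.neg_apply, map_neg, h1]

instance dualModule (M : PMod n X) (U : Opens X) : Module (Hol n X U) (dualSec M U) where
  smul f φ := ⟨fun W => Hol.res n W.2 f • φ.1 W, fun W W' h s => by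
    have h1 := φ.2 W W' h s
    simp only [LinearMap.smul_apply, smul_eq_mul, map_mul, h1]
    rfl⟩
  one_smul φ := Subtype.ext (funext fun W => by
    change Hol.res n W.2 1 • φ.1 W = φ.1 W
    rw [map_one, one_smul])
  mul_smul f g φ := Subtype.ext (funext fun W => by
    change Hol.res n W.2 (f * g) • φ.1 W = Hol.res n W.2 f • Hol.res n W.2 g • φ.1 W
    rw [map_mul, mul_smul])
  smul_zero f := Subtype.ext (funext fun W => smul_zero (Hol.res n W.2 f))
  smul_add f φ ψ := Subtype.ext (funext fun W => smul_add (Hol.res n W.2 f) (φ.1 W) (ψ.1 W))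
  add_smul f g φ := Subtype.ext (funext fun W => by
    change Hol.res n W.2 (f + g) • φ.1 W = Hol.res n W.2 f • φ.1 W + Hol.res n W.2 g • φ.1 W
    rw [map_add, add_smul])
  zero_smul φ := Subtype.ext (funext fun W => by
    change Hol.res n W.2 0 • φ.1 W = 0
    rw [map_zero, zero_smul])

/-- The underlying presheaf of abelian groups of the dual. -/
def dualPresheaf (M : PMod n X) : TopCat.Presheaf AddCommGrpCat.{u} (TopCat.of X) where
  obj U := AddCommGrpCat.of (dualSec M U.unop)
  map i := AddCommGrpCat.ofHom
    { toFun φ := ⟨fun W => φ.1 ⟨W.1, W.2.trans i.unop.le⟩, fun W W' h s =>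
        φ.2 ⟨W.1, W.2.trans i.unop.le⟩ ⟨W'.1, W'.2.trans i.unop.le⟩ h s⟩
      map_zero' := rfl
      map_add' _ _ := rfl }
  map_id _ := rfl
  map_comp _ _ := rfl

/-- The dual of a presheaf of `𝒪_X`-modules. -/
def dual (M : PMod n X) : PMod n X :=
  letI (U : (Opens (TopCat.of X))ᵒᵖ) :
      Module ((ringSheaf n X).obj.obj U) ((dualPresheaf M).obj U) := dualModule M U.unop
  PresheafOfModules.ofPresheaf (dualPresheaf M) (fun _ _ _ _ _ => rfl)

/-- The canonical map to the bidual, on sections over `U`: evaluation of functionals. -/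
def toBidual (M : PMod n X) (U : Opens X) (s : PSec M U) : PSec (dual (dual M)) U :=
  (⟨fun W =>
    { toFun φ := (φ : dualSec M W.1).1 ⟨W.1, le_rfl⟩ (pres M W.2 s)
      map_add' _ _ := rfl
      map_smul' _ _ := rfl },
    fun W W' h φ => by
      have h1 := (φ : dualSec M W.1).2 ⟨W.1, le_rfl⟩ ⟨W'.1, h⟩ h (pres M W.2 s)
      rw [pres_pres] at h1
      exact h1⟩ : dualSec (dual M) U)

/-- Reflexive sheaves: coherent (over `𝒪_X`, this means locally of finite presentation) and
canonically isomorphic to the bidual. -/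
structure IsReflexive (M : OMod n X) : Prop where
  coherent : M.IsFinitePresentation
  bijective : ∀ U : Opens X, Function.Bijective (toBidual M.val U)

end Sections

section FibreSheaves

variable {n : ℕ} {X : Type u} [TopologicalSpace X]

/-- A sheaf of abelian groups whose sections over `U` are families of elements of given groups
`F x`, `x ∈ U`. -/
structure FibSheaf (F : X → Type) [∀ x, AddCommGroup (F x)] where
  sec : ∀ U : Opens X, AddSubgroup (∀ x : U, F x)
  res_mem : ∀ {U V : Opens X} (h : V ≤ U) (v : ∀ x : U, F x), v ∈ sec U →
    (fun x : V => v ⟨x.1, h x.2⟩) ∈ sec V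
  local_mem : ∀ {U : Opens X} (v : ∀ x : U, F x),
    (∀ x : U, ∃ (V : Opens X) (_ : x.1 ∈ V) (h : V ≤ U),
      (fun y : V => v ⟨y.1, h y.2⟩) ∈ sec V) → v ∈ sec U

namespace FibSheaf

variable {F : X → Type} [∀ x, AddCommGroup (F x)] (P : FibSheaf F)

/-- Membership in `P`, as a local predicate. -/
def pred : TopCat.LocalPredicate (X := TopCat.of X) F where
  pred {U} v := v ∈ P.sec U
  res i v hv := P.res_mem i.le v hv
  locality {U} v hv := P.local_mem v fun x => by
    obtain ⟨V, hx, i, hV⟩ := hv x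
    exact ⟨V, hx, i.le, hV⟩

/-- The presheaf of abelian groups of sections of `P`. -/
def toPresheaf : TopCat.Presheaf AddCommGrpCat.{u} (TopCat.of X) where
  obj U := AddCommGrpCat.of (P.sec U.unop)
  map i := AddCommGrpCat.ofHom
    { toFun v := ⟨fun x => v.1 ⟨x.1, i.unop.le x.2⟩, P.res_mem i.unop.le v.1 v.2⟩
      map_zero' := rfl
      map_add' _ _ := rfl }
  map_id _ := rfl
  map_comp _ _ := rfl

lemma toPresheaf_isSheaf : P.toPresheaf.IsSheaf := by
  unfold TopCat.Presheaf.IsSheaf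
  rw [CategoryTheory.Presheaf.isSheaf_iff_isSheaf_forget _ _ (CategoryTheory.forget AddCommGrpCat)]
  exact TopCat.subpresheafToTypes.isSheaf P.pred

/-- The sheaf of abelian groups of sections of `P`. -/
def toSheaf : TopCat.Sheaf AddCommGrpCat.{u} (TopCat.of X) := ⟨P.toPresheaf, P.toPresheaf_isSheaf⟩

variable [ChartedSpace (Cn n) X] [∀ x, Module ℂ (F x)]

variable (n) in
/-- `P` is stable under multiplication by holomorphic functions. -/
def SMulClosed : Prop :=
  ∀ (U : Opens X) (f : Hol n X U) (v : ∀ x : U, F x), v ∈ P.sec U →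
    (fun x => f.1 x • v x) ∈ P.sec U

variable {P} in
/-- The pointwise `𝒪_X(U)`-module structure on sections over `U`. -/
@[reducible]
def secModule (hP : P.SMulClosed n) (U : Opens X) : Module (Hol n X U) (P.sec U) where
  smul f v := ⟨fun x => f.1 x • v.1 x, hP U f v.1 v.2⟩
  one_smul v := Subtype.ext (funext fun x => one_smul ℂ (v.1 x))
  mul_smul f g v := Subtype.ext (funext fun x => mul_smul (f.1 x) (g.1 x) (v.1 x))
  smul_zero f := Subtype.ext (funext fun x => smul_zero (f.1 x))
  smul_add f v w := Subtype.ext (funext fun x => smul_add (f.1 x) (v.1 x) (w.1 x))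
  add_smul f g v := Subtype.ext (funext fun x => add_smul (f.1 x) (g.1 x) (v.1 x))
  zero_smul v := Subtype.ext (funext fun x => zero_smul ℂ (v.1 x))

variable {P} in
/-- The sheaf of `𝒪_X`-modules of sections of `P`. -/
def toModule (hP : P.SMulClosed n) : OMod n X where
  val :=
    letI (U : (Opens (TopCat.of X))ᵒᵖ) :
        Module ((ringSheaf n X).obj.obj U) (P.toPresheaf.obj U) := secModule hP U.unop
    PresheafOfModules.ofPresheaf P.toPresheaf (fun _ _ _ _ _ => rfl)
  isSheaf := P.toPresheaf_isSheaf

variable {P} {G : X → Type} [∀ x, AddCommGroup (G x)] [∀ x, Module ℂ (G x)] {Q : FibSheaf G}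

/-- The morphism of sheaves of modules given by fibrewise linear maps. -/
def moduleHom (hP : P.SMulClosed n) (hQ : Q.SMulClosed n) (L : ∀ x, F x →ₗ[ℂ] G x)
    (hL : ∀ (U : Opens X) (v : ∀ x : U, F x), v ∈ P.sec U → (fun x : U => L x.1 (v x)) ∈ Q.sec U) :
    toModule hP ⟶ toModule hQ where
  val := PresheafOfModules.homMk
    { app U := AddCommGrpCat.ofHom
        { toFun v := ⟨fun x => L x.1 (v.1 x), hL U.unop v.1 v.2⟩
          map_zero' := Subtype.ext (funext fun x => map_zero (L x.1))
          map_add' v w := Subtype.ext (funext fun x => map_add (L x.1) (v.1 x) (w.1 x)) }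
      naturality _ _ _ := rfl }
    (fun _ f v => Subtype.ext (funext fun x => (L x.1).map_smul (f.1 x) (v.1 x)))

end FibSheaf

end FibreSheaves

section TangentSheaves

variable {n m k : ℕ} {X S M : Type u}
  [TopologicalSpace X] [ChartedSpace (Cn n) X]
  [TopologicalSpace S] [ChartedSpace (Cn m) S]
  [TopologicalSpace M] [ChartedSpace (Cn k) M] [IsManifold 𝓘(ℂ, Cn k) ω M]

variable (n k) in
/-- Holomorphic vector fields on `U` along a map `g : X → M`: they assign to `x ∈ U`
a tangent vector of `M` at `g x`. -/
def IsHolAlong (g : X → M) (U : Opens X) (v : ∀ x : U, TangentSpace 𝓘(ℂ, Cn k) (g x)) : Prop :=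
  ContMDiff 𝓘(ℂ, Cn n) 𝓘(ℂ, Cn k).tangent ω
    (fun x : U => (⟨g x, v x⟩ : TangentBundle 𝓘(ℂ, Cn k) M))

lemma isHolAlong_iff {g : X → M} (hg : ContMDiff 𝓘(ℂ, Cn n) 𝓘(ℂ, Cn k) ω g) {U : Opens X}
    {v : ∀ x : U, TangentSpace 𝓘(ℂ, Cn k) (g x)} :
    IsHolAlong n k g U v ↔ ∀ x₀ : U, ContMDiffAt 𝓘(ℂ, Cn n) 𝓘(ℂ, Cn k) ω (fun x : U =>
      (trivializationAt (Cn k) (TangentSpace 𝓘(ℂ, Cn k)) (g x₀)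
        (⟨g x, v x⟩ : TangentBundle 𝓘(ℂ, Cn k) M)).2) x₀ := by
  have hgU : ContMDiff 𝓘(ℂ, Cn n) 𝓘(ℂ, Cn k) ω (fun x : U => g x) :=
    hg.comp contMDiff_subtype_val
  refine forall_congr' fun x₀ => ?_
  rw [Bundle.contMDiffAt_totalSpace]
  exact and_iff_right (hgU x₀)

lemma eventually_mem_baseSet {g : X → M} (hg : ContMDiff 𝓘(ℂ, Cn n) 𝓘(ℂ, Cn k) ω g)
    {U : Opens X} (x₀ : U) : ∀ᶠ x : U in nhds x₀,
      g x ∈ (trivializationAt (Cn k) (TangentSpace 𝓘(ℂ, Cn k)) (g x₀)).baseSet := by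
  have hgU : Continuous (fun x : U => g x) := hg.continuous.comp continuous_subtype_val
  exact hgU.continuousAt.eventually_mem
    ((trivializationAt (Cn k) (TangentSpace 𝓘(ℂ, Cn k)) (g x₀)).open_baseSet.mem_nhds
      (FiberBundle.mem_baseSet_trivializationAt' _))

lemma IsHolAlong.lincomb {g : X → M} (hg : ContMDiff 𝓘(ℂ, Cn n) 𝓘(ℂ, Cn k) ω g) {U : Opens X}
    {v w : ∀ x : U, TangentSpace 𝓘(ℂ, Cn k) (g x)} (hv : IsHolAlong n k g U v)
    (hw : IsHolAlong n k g U w) (f h : Hol n X U) :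
    IsHolAlong n k g U (fun x => f.1 x • v x + h.1 x • w x) := by
  rw [isHolAlong_iff hg] at hv hw ⊢
  intro x₀
  refine ((ContMDiffAt.smul (f.2 x₀) (hv x₀)).add
    (ContMDiffAt.smul (h.2 x₀) (hw x₀))).congr_of_eventuallyEq ?_
  filter_upwards [eventually_mem_baseSet hg x₀] with x hx
  have L := (trivializationAt (Cn k) (TangentSpace 𝓘(ℂ, Cn k)) (g x₀)).linear ℂ hx
  rw [L.map_add, L.map_smul, L.map_smul]
  rfl

lemma isHolAlong_zero {g : X → M} (hg : ContMDiff 𝓘(ℂ, Cn n) 𝓘(ℂ, Cn k) ω g) (U : Opens X) :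
    IsHolAlong n k g U (fun _ => 0) := by
  rw [isHolAlong_iff hg]
  intro x₀
  refine (contMDiffAt_const (c := (0 : Cn k))).congr_of_eventuallyEq ?_
  filter_upwards [eventually_mem_baseSet hg x₀] with x hx
  exact ((trivializationAt (Cn k) (TangentSpace 𝓘(ℂ, Cn k)) (g x₀)).linear ℂ hx).map_zero

lemma IsHolAlong.smul {g : X → M} (hg : ContMDiff 𝓘(ℂ, Cn n) 𝓘(ℂ, Cn k) ω g) {U : Opens X}
    {v : ∀ x : U, TangentSpace 𝓘(ℂ, Cn k) (g x)} (hv : IsHolAlong n k g U v) (f : Hol n X U) :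
    IsHolAlong n k g U (fun x => f.1 x • v x) := by
  convert hv.lincomb hg hv f 0 using 2 with x
  change _ = f.1 x • v x + (0 : ℂ) • v x
  rw [zero_smul, add_zero]

lemma IsHolAlong.add {g : X → M} (hg : ContMDiff 𝓘(ℂ, Cn n) 𝓘(ℂ, Cn k) ω g) {U : Opens X}
    {v w : ∀ x : U, TangentSpace 𝓘(ℂ, Cn k) (g x)} (hv : IsHolAlong n k g U v)
    (hw : IsHolAlong n k g U w) : IsHolAlong n k g U (fun x => v x + w x) := by
  convert hv.lincomb hg hw 1 1 using 2 with x
  change _ = (1 : ℂ) • v x + (1 : ℂ) • w x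
  rw [one_smul, one_smul]

lemma IsHolAlong.neg {g : X → M} (hg : ContMDiff 𝓘(ℂ, Cn n) 𝓘(ℂ, Cn k) ω g) {U : Opens X}
    {v : ∀ x : U, TangentSpace 𝓘(ℂ, Cn k) (g x)} (hv : IsHolAlong n k g U v) :
    IsHolAlong n k g U (fun x => -v x) := by
  convert hv.smul hg (-1) using 2 with x
  change _ = (-1 : ℂ) • v x
  rw [neg_one_smul]

lemma IsHolAlong.restrict {g : X → M} {U V : Opens X} (h : V ≤ U)
    {v : ∀ x : U, TangentSpace 𝓘(ℂ, Cn k) (g x)} (hv : IsHolAlong n k g U v) :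
    IsHolAlong n k g V (fun x => v ⟨x.1, h x.2⟩) :=
  ContMDiff.comp (I' := 𝓘(ℂ, Cn n)) (g := fun x : U => (⟨g x.1, v x⟩ :
    TangentBundle 𝓘(ℂ, Cn k) M)) hv (contMDiff_inclusion h)

/-- The sheaf of holomorphic vector fields along a holomorphic map `g : X → M`, that is, of
holomorphic sections of the pulled back bundle `g^*TM`. -/
def alongSheaf {g : X → M} (hg : ContMDiff 𝓘(ℂ, Cn n) 𝓘(ℂ, Cn k) ω g) :
    FibSheaf (fun x : X => TangentSpace 𝓘(ℂ, Cn k) (g x)) where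
  sec U :=
    { carrier := {v | IsHolAlong n k g U v}
      add_mem' hv hw := IsHolAlong.add hg hv hw
      zero_mem' := isHolAlong_zero hg U
      neg_mem' hv := IsHolAlong.neg hg hv }
  res_mem h _ hv := IsHolAlong.restrict h hv
  local_mem _ hv := contMDiff_of_locally n _ hv

lemma alongSheaf_smul {g : X → M} (hg : ContMDiff 𝓘(ℂ, Cn n) 𝓘(ℂ, Cn k) ω g) :
    (alongSheaf hg).SMulClosed n :=
  fun U f _ hv => IsHolAlong.smul (U := U) hg hv f

variable (n X) in
/-- The tangent sheaf `T_X`: holomorphic vector fields. -/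
def tangentSheaf [IsManifold 𝓘(ℂ, Cn n) ω X] : OMod n X := FibSheaf.toModule (alongSheaf_smul (contMDiff_id (M := X)))

section Derivative

variable [IsManifold 𝓘(ℂ, Cn n) ω X]

/-- Extension by zero of a function on an open subset. -/
def extZero {U : Opens X} (f : U → ℂ) : X → ℂ := Function.extend Subtype.val f 0

lemma extZero_apply {U : Opens X} (f : U → ℂ) (x : U) : extZero f x.1 = f x :=
  Subtype.val_injective.extend_apply f 0 x

lemma extZero_contMDiffOn {U : Opens X} (f : Hol n X U) :
    ContMDiffOn 𝓘(ℂ, Cn n) 𝓘(ℂ, ℂ) ω (extZero f.1) (U : Set X) := by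
  intro x hx
  refine ContMDiffAt.contMDiffWithinAt ?_
  have h := (contMDiffAt_subtype_iff (I := 𝓘(ℂ, Cn n)) (I' := 𝓘(ℂ, ℂ)) (n := ω) (U := U)
    (f := extZero f.1) (x := ⟨x, hx⟩)).1
  refine h ?_
  have h' : (fun y : U => extZero f.1 y.1) = f.1 := funext fun y => extZero_apply f.1 y
  rw [h']
  exact f.2 ⟨x, hx⟩

lemma tangentMap_comp_contMDiff {E' H' N : Type*} [NormedAddCommGroup E'] [NormedSpace ℂ E']
    [TopologicalSpace H'] {I' : ModelWithCorners ℂ E' H'} [TopologicalSpace N]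
    [ChartedSpace H' N] [IsManifold I' ω N] {U : Opens X} {f : X → N}
    (hf : ContMDiffOn 𝓘(ℂ, Cn n) I' ω f (U : Set X))
    {v : ∀ x : U, TangentSpace 𝓘(ℂ, Cn n) (id x.1 : X)} (hv : IsHolAlong n n id U v) :
    ContMDiff 𝓘(ℂ, Cn n) I'.tangent ω (fun x : U =>
      (⟨f x, mfderiv 𝓘(ℂ, Cn n) I' f x.1 (v x)⟩ : TangentBundle I' N)) := by
  have h1 := hf.contMDiffOn_tangentMapWithin (m := ω) le_rfl U.isOpen.uniqueMDiffOn
  have h2 : ContMDiff 𝓘(ℂ, Cn n) I'.tangent ω (fun x : U =>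
      tangentMapWithin 𝓘(ℂ, Cn n) I' f (U : Set X)
        (⟨x.1, v x⟩ : TangentBundle 𝓘(ℂ, Cn n) X)) :=
    h1.comp_contMDiff hv (fun x => x.2)
  convert h2 using 2 with x
  simp only [tangentMapWithin, mfderivWithin_of_isOpen U.isOpen x.2]

/-- The derivative `v(f)` of a holomorphic function along a holomorphic vector field. -/
def derivAlong {U : Opens X} (v : Sec (tangentSheaf n X) U) (f : Hol n X U) : Hol n X U :=
  ⟨fun x => mfderiv 𝓘(ℂ, Cn n) 𝓘(ℂ, ℂ) (extZero f.1) x.1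
      ((v : (alongSheaf (contMDiff_id (M := X))).sec U).1 x),
    (contMDiff_snd_tangentBundle_modelSpace ℂ 𝓘(ℂ, ℂ)).comp (tangentMap_comp_contMDiff
      (extZero_contMDiffOn f) (v : (alongSheaf (contMDiff_id (M := X))).sec U).2)⟩

lemma derivAlong_add {U : Opens X} (v w : Sec (tangentSheaf n X) U) (f : Hol n X U) :
    derivAlong (v + w) f = derivAlong v f + derivAlong w f :=
  Subtype.ext (funext fun _ => map_add (mfderiv 𝓘(ℂ, Cn n) 𝓘(ℂ, ℂ) (extZero f.1) _) _ _)

lemma derivAlong_neg {U : Opens X} (v : Sec (tangentSheaf n X) U) (f : Hol n X U) :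
    derivAlong (-v) f = -derivAlong v f :=
  Subtype.ext (funext fun _ => map_neg (mfderiv 𝓘(ℂ, Cn n) 𝓘(ℂ, ℂ) (extZero f.1) _) _)

lemma derivAlong_zero {U : Opens X} (f : Hol n X U) :
    derivAlong (0 : Sec (tangentSheaf n X) U) f = 0 :=
  Subtype.ext (funext fun _ => map_zero (mfderiv 𝓘(ℂ, Cn n) 𝓘(ℂ, ℂ) (extZero f.1) _))

lemma derivAlong_res {U V : Opens X} (h : V ≤ U) (v : Sec (tangentSheaf n X) U)
    (f : Hol n X U) :
    derivAlong (res (tangentSheaf n X) h v) (Hol.res n h f) = Hol.res n h (derivAlong v f) := by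
  refine Subtype.ext (funext fun x => ?_)
  have hE : extZero (Hol.res n h f).1 =ᶠ[nhds x.1] extZero f.1 := by
    filter_upwards [V.isOpen.mem_nhds x.2] with y hy
    rw [extZero_apply _ (⟨y, hy⟩ : V), extZero_apply _ (⟨y, h hy⟩ : U)]
    rfl
  change mfderiv _ _ (extZero (Hol.res n h f).1) x.1 _ = mfderiv _ _ (extZero f.1) x.1 _
  rw [hE.mfderiv_eq]
  rfl

end Derivative

section Submersion

variable [IsManifold 𝓘(ℂ, Cn n) ω X] [IsManifold 𝓘(ℂ, Cn m) ω S]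

variable (n m) in
/-- Smooth morphisms of complex manifolds, i.e. holomorphic submersions: locally on the source,
projections from a product, in suitable holomorphic charts. -/
abbrev IsSmoothMorphism (π : X → S) : Prop :=
  Manifold.IsSubmersion 𝓘(ℂ, Cn n) 𝓘(ℂ, Cn m) ω π

variable {π : X → S} (hπ : IsSmoothMorphism n m π)

/-- The sheaf `π^*T_S`: holomorphic sections of the pulled back tangent bundle of `S`. -/
def pullbackTangent : OMod n X := FibSheaf.toModule (alongSheaf_smul hπ.contMDiff)

/-- The differential `T_X → π^*T_S` of `π`. -/
def differential : tangentSheaf n X ⟶ pullbackTangent hπ :=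
  FibSheaf.moduleHom _ _ (fun x => (mfderiv 𝓘(ℂ, Cn n) 𝓘(ℂ, Cn m) π x).toLinearMap)
    (fun _ _ hv => tangentMap_comp_contMDiff hπ.contMDiff.contMDiffOn hv)

variable (n m π) in
/-- Vertical holomorphic vector fields, i.e. those tangent to the fibres of `π`. -/
def verticalFib : FibSheaf (fun x : X => TangentSpace 𝓘(ℂ, Cn n) (id x)) where
  sec U :=
    { carrier := {v | v ∈ (alongSheaf (contMDiff_id (M := X))).sec U ∧
        ∀ x : U, mfderiv 𝓘(ℂ, Cn n) 𝓘(ℂ, Cn m) π x.1 (v x) = 0}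
      add_mem' {v w} hv hw := ⟨add_mem hv.1 hw.1, fun x => by
        rw [Pi.add_apply]
        exact (map_add (mfderiv 𝓘(ℂ, Cn n) 𝓘(ℂ, Cn m) π x.1) (v x) (w x)).trans
          (by rw [hv.2 x, hw.2 x, add_zero])⟩
      zero_mem' := ⟨zero_mem _, fun x => map_zero (mfderiv 𝓘(ℂ, Cn n) 𝓘(ℂ, Cn m) π x.1)⟩
      neg_mem' {v} hv := ⟨neg_mem hv.1, fun x => by
        rw [Pi.neg_apply]
        exact (map_neg (mfderiv 𝓘(ℂ, Cn n) 𝓘(ℂ, Cn m) π x.1) (v x)).trans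
          (by rw [hv.2 x, neg_zero])⟩ }
  res_mem h v hv := ⟨(alongSheaf contMDiff_id).res_mem h v hv.1, fun x => hv.2 ⟨x.1, h x.2⟩⟩
  local_mem v hv := by
    refine ⟨(alongSheaf contMDiff_id).local_mem v fun x => ?_, fun x => ?_⟩
    · obtain ⟨V, hx, h, hV⟩ := hv x
      exact ⟨V, hx, h, hV.1⟩
    · obtain ⟨V, hx, h, hV⟩ := hv x
      exact hV.2 ⟨x.1, hx⟩

lemma verticalFib_smul : (verticalFib n m π).SMulClosed n :=
  fun U f _ hv => ⟨alongSheaf_smul (contMDiff_id (M := X)) U f _ hv.1, fun x =>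
    (map_smul (mfderiv 𝓘(ℂ, Cn n) 𝓘(ℂ, Cn m) π x.1) (f.1 x) _).trans
      (by rw [hv.2 x, smul_zero])⟩

variable (n m π) in
/-- The relative tangent sheaf `T_{X|S}`: holomorphic vector fields tangent to the fibres. -/
def relTangent : OMod n X := FibSheaf.toModule (verticalFib_smul (n := n) (m := m) (π := π))

variable (n m π) in
/-- The inclusion `T_{X|S} → T_X`. -/
def relTangentIncl : relTangent n m π ⟶ tangentSheaf n X :=
  FibSheaf.moduleHom _ _ (fun _ => LinearMap.id) (fun _ _ hv => hv.1)

lemma relTangentIncl_differential : relTangentIncl n m π ≫ differential hπ = 0 := by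
  refine SheafOfModules.hom_ext (PresheafOfModules.hom_ext fun U => ?_)
  refine ModuleCat.hom_ext (LinearMap.ext fun v => Subtype.ext (funext fun x => ?_))
  exact (v : (verticalFib n m π).sec U.unop).2.2 x

lemma contMDiff_opens_iff {W : Opens S} {U : Opens X} (f : U → W) :
    ContMDiff 𝓘(ℂ, Cn n) 𝓘(ℂ, Cn m) ω (Subtype.val ∘ f) ↔
      ContMDiff 𝓘(ℂ, Cn n) 𝓘(ℂ, Cn m) ω f :=
  forall_congr' fun _ => ChartedSpace.liftPropWithinAt_subtypeVal_comp_iff ..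

/-- Basic vector fields: sections of `π^*T_S` that are locally of the form `x ↦ Z (π x)` for a
holomorphic vector field `Z` on an open subset of `S`. -/
def IsBasic (π : X → S) (U : Opens X) (v : ∀ x : U, TangentSpace 𝓘(ℂ, Cn m) (π x)) : Prop :=
  ∀ x : U, ∃ (V : Opens X) (_ : x.1 ∈ V) (hVU : V ≤ U) (W : Opens S) (hVW : ∀ y ∈ V, π y ∈ W)
    (Z : ∀ s : W, TangentSpace 𝓘(ℂ, Cn m) (id s.1)),
    IsHolAlong m m id W Z ∧ ∀ y : V, v ⟨y.1, hVU y.2⟩ = Z ⟨π y.1, hVW y.1 y.2⟩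

lemma IsBasic.add {U : Opens X} {v w : ∀ x : U, TangentSpace 𝓘(ℂ, Cn m) (π x)}
    (hv : IsBasic π U v) (hw : IsBasic π U w) : IsBasic π U (fun x => v x + w x) := by
  intro x
  obtain ⟨V, hx, hVU, W, hVW, Z, hZ, hvZ⟩ := hv x
  obtain ⟨V', hx', hVU', W', hVW', Z', hZ', hvZ'⟩ := hw x
  refine ⟨V ⊓ V', ⟨hx, hx'⟩, inf_le_left.trans hVU, W ⊓ W',
    fun y hy => ⟨hVW y hy.1, hVW' y hy.2⟩, fun s => Z ⟨s.1, s.2.1⟩ + Z' ⟨s.1, s.2.2⟩,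
    (hZ.restrict inf_le_left).add contMDiff_id (hZ'.restrict inf_le_right), fun y =>
      congrArg₂ (· + ·) (hvZ ⟨y.1, y.2.1⟩) (hvZ' ⟨y.1, y.2.2⟩)⟩

lemma IsBasic.neg {U : Opens X} {v : ∀ x : U, TangentSpace 𝓘(ℂ, Cn m) (π x)}
    (hv : IsBasic π U v) : IsBasic π U (fun x => -v x) := by
  intro x
  obtain ⟨V, hx, hVU, W, hVW, Z, hZ, hvZ⟩ := hv x
  exact ⟨V, hx, hVU, W, hVW, fun s => -Z s, hZ.neg contMDiff_id, fun y => congrArg Neg.neg (hvZ y)⟩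

lemma isBasic_zero (U : Opens X) : IsBasic (m := m) π U (fun _ => 0) := fun x =>
  ⟨U, x.2, le_rfl, ⊤, fun _ _ => trivial, fun _ => 0,
    isHolAlong_zero (n := m) (k := m) contMDiff_id ⊤, fun _ => rfl⟩

variable (m π) in
/-- Basic vector fields, as families of vectors. -/
def basicFib : FibSheaf (fun x : X => TangentSpace 𝓘(ℂ, Cn m) (π x)) where
  sec U :=
    { carrier := {v | IsBasic π U v}
      add_mem' hv hw := IsBasic.add hv hw
      zero_mem' := isBasic_zero U
      neg_mem' hv := IsBasic.neg hv }
  res_mem {U V'} h v hv := fun x => by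
    obtain ⟨V, hx, hVU, W, hVW, Z, hZ, hvZ⟩ := hv ⟨x.1, h x.2⟩
    exact ⟨V ⊓ V', ⟨hx, x.2⟩, inf_le_right, W, fun y hy => hVW y hy.1, Z, hZ,
      fun y => hvZ ⟨y.1, y.2.1⟩⟩
  local_mem v hv := fun x => by
    obtain ⟨V', hx', h, hV'⟩ := hv x
    obtain ⟨V, hx, hVU, W, hVW, Z, hZ, hvZ⟩ := hV' ⟨x.1, hx'⟩
    exact ⟨V, hx, hVU.trans h, W, hVW, Z, hZ, hvZ⟩

lemma IsBasic.isHolAlong (hπ : IsSmoothMorphism n m π) {U : Opens X} {v : ∀ x : U, TangentSpace 𝓘(ℂ, Cn m) (π x)}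
    (hv : IsBasic π U v) : IsHolAlong n m π U v := by
  refine contMDiff_of_locally n _ fun x => ?_
  obtain ⟨V, hx, hVU, W, hVW, Z, hZ, hvZ⟩ := hv x
  refine ⟨V, hx, hVU, ?_⟩
  have h1 : ContMDiff 𝓘(ℂ, Cn n) 𝓘(ℂ, Cn m) ω (fun y : V => (⟨π y.1, hVW y.1 y.2⟩ : W)) := by
    rw [← contMDiff_opens_iff]
    exact hπ.contMDiff.comp contMDiff_subtype_val
  have h2 := ContMDiff.comp (g := fun s : W => (⟨s.1, Z s⟩ : TangentBundle 𝓘(ℂ, Cn m) S)) hZ h1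
  convert h2 using 2 with y
  simp only [Function.comp_apply, hvZ y]

variable (m π) in
/-- The sheaf `π⁻¹T_S` of basic vector fields. -/
def basicSheaf : TopCat.Sheaf AddCommGrpCat.{u} (TopCat.of X) := (basicFib m π).toSheaf

/-- The sheaf of abelian groups underlying a sheaf of modules. -/
abbrev ab (M : OMod n X) : TopCat.Sheaf AddCommGrpCat.{u} (TopCat.of X) :=
  (SheafOfModules.toSheaf (ringSheaf n X)).obj M

/-- The morphism of sheaves of abelian groups underlying a morphism of sheaves of modules. -/
abbrev abMap {M N : OMod n X} (φ : M ⟶ N) : ab M ⟶ ab N :=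
  (SheafOfModules.toSheaf (ringSheaf n X)).map φ

/-- The inclusion `π⁻¹T_S → π^*T_S`. -/
def basicIncl : basicSheaf m π ⟶ ab (pullbackTangent hπ) where
  hom :=
    { app U := AddCommGrpCat.ofHom
        { toFun v := (⟨(v : (basicFib m π).sec U.unop).1, IsBasic.isHolAlong hπ
            (v : (basicFib m π).sec U.unop).2⟩ : (alongSheaf hπ.contMDiff).sec U.unop)
          map_zero' := rfl
          map_add' _ _ := rfl }
      naturality _ _ _ := rfl }

/-- The sections of a sheaf of abelian groups over an open set. -/
abbrev AbSec (F : TopCat.Sheaf AddCommGrpCat.{u} (TopCat.of X)) (U : Opens X) : Type u :=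
  F.obj.obj (op U)

/-- The action of a morphism of sheaves of abelian groups on sections. -/
abbrev onAbSec {F G : TopCat.Sheaf AddCommGrpCat.{u} (TopCat.of X)} (φ : F ⟶ G) (U : Opens X) :
    AbSec F U →+ AbSec G U :=
  (φ.hom.app (op U)).hom

/-- The comorphism `𝒪_S → π_*𝒪_X`, `f ↦ f ∘ π`. -/
def comorphism : (structureSheaf m S).presheaf ⟶
    (TopCat.Presheaf.pushforward CommRingCat.{u}
      (TopCat.ofHom ⟨π, hπ.contMDiff.continuous⟩)).obj (structureSheaf n X).presheaf where
  app W := CommRingCat.ofHom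
    { toFun f := (⟨fun x => f.1 ⟨π x.1, x.2⟩, by
        refine ContMDiff.comp (I' := 𝓘(ℂ, Cn m)) (g := f.1) f.2 ?_
        rw [← contMDiff_opens_iff]
        exact hπ.contMDiff.comp contMDiff_subtype_val⟩ : Hol n X ⟨π ⁻¹' W.unop,
          W.unop.isOpen.preimage hπ.contMDiff.continuous⟩)
      map_one' := rfl
      map_mul' _ _ := rfl
      map_zero' := rfl
      map_add' _ _ := rfl }
  naturality _ _ _ := rfl

/-- The local homomorphism `𝒪_{S,π(x)} → 𝒪_{X,x}`. -/
def stalkHom (x : X) : (structureSheaf m S).presheaf.stalk (π x) ⟶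
    (structureSheaf n X).presheaf.stalk x :=
  (TopCat.Presheaf.stalkFunctor CommRingCat.{u} (π x : TopCat.of S)).map (comorphism hπ) ≫
    TopCat.Presheaf.stalkPushforward CommRingCat.{u}
      (TopCat.ofHom ⟨π, hπ.contMDiff.continuous⟩) (structureSheaf n X).presheaf x

/-- The stalk of a sheaf of `𝒪_X`-modules. -/
abbrev Stalk (M : OMod n X) (x : X) : Type u :=
  TopCat.Presheaf.stalk (C := AddCommGrpCat.{u}) (X := TopCat.of X) M.val.presheaf x

instance (M : OMod n X) (x : X) :
    Module ((structureSheaf n X).presheaf.stalk x) (Stalk M x) :=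
  PresheafOfModules.instModuleCarrierStalkCommRingCatCarrierAbPresheafOpensCarrier (R := (structureSheaf n X).presheaf) M.val x

/-- Flatness over `S` of a sheaf of `𝒪_X`-modules: every stalk is flat over the corresponding
local ring of `S`. -/
def IsFlatOver (M : OMod n X) : Prop :=
  ∀ x : X,
    letI := Module.compHom (Stalk M x) (stalkHom hπ x).hom
    Module.Flat ((structureSheaf m S).presheaf.stalk (π x)) (Stalk M x)

/-- The rank at `x` of a sheaf of `𝒪_X`-modules, i.e. the rank of the stalk over the local ring
(an integral domain): the maximal number of linearly independent elements. -/
def rankAt (M : OMod n X) (x : X) : ℕ :=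
  Module.finrank ((structureSheaf n X).presheaf.stalk x) (Stalk M x)

end Submersion

end TangentSheaves

section Algebroids

section Gluing

variable {n : ℕ} {X : Type u} [TopologicalSpace X] [ChartedSpace (Cn n) X]

lemma sec_glue (M : OMod n X) {ι : Type u} {W : Opens X} (V : ι → Opens X)
    (hV : ∀ i, V i ≤ W) (hc : W ≤ iSup V) (s : ∀ i, Sec M (V i))
    (hs : ∀ i j, res M (inf_le_left : V i ⊓ V j ≤ V i) (s i) =
      res M (inf_le_right : V i ⊓ V j ≤ V j) (s j)) :
    ∃! t : Sec M W, ∀ i, res M (hV i) t = s i :=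
  TopCat.Sheaf.existsUnique_gluing' (X := TopCat.of X) (C := AddCommGrpCat.{u})
    ⟨M.val.presheaf, M.isSheaf⟩ V W (fun i => homOfLE (hV i)) hc s hs

lemma sec_ext (M : OMod n X) {ι : Type u} {W : Opens X} (V : ι → Opens X)
    (hV : ∀ i, V i ≤ W) (hc : W ≤ iSup V) (s t : Sec M W)
    (h : ∀ i, res M (hV i) s = res M (hV i) t) : s = t :=
  TopCat.Sheaf.eq_of_locally_eq' (X := TopCat.of X) (C := AddCommGrpCat.{u})
    ⟨M.val.presheaf, M.isSheaf⟩ V W (fun i => homOfLE (hV i)) hc s t h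

end Gluing

section Structures

variable {n : ℕ} {X : Type u} [TopologicalSpace X] [ChartedSpace (Cn n) X]
  [IsManifold 𝓘(ℂ, Cn n) ω X]

/-- A bracket on a sheaf of `𝒪_X`-modules `M`, making it a Lie algebroid with anchor
`a : M → T_X` (apart from reflexivity). The `ℂ`-linearity of the bracket, and its linearity over
`π⁻¹𝒪_S` when the anchor takes values in `T_{X|S}`, are special cases of the Leibniz rule. -/
structure LieStructure (M : OMod n X) (a : M ⟶ tangentSheaf n X) where
  /-- the bracket `{u, v}` -/
  bracket : ∀ U : Opens X, Sec M U →+ Sec M U →+ Sec M U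
  bracket_res : ∀ {U V : Opens X} (h : V ≤ U) (u v : Sec M U),
    bracket V (res M h u) (res M h v) = res M h (bracket U u v)
  skew : ∀ {U : Opens X} (u v : Sec M U), bracket U v u = -bracket U u v
  jacobi : ∀ {U : Opens X} (u v w : Sec M U),
    bracket U u (bracket U v w) + bracket U v (bracket U w u) + bracket U w (bracket U u v) = 0
  leibniz : ∀ {U : Opens X} (g : Hol n X U) (u v : Sec M U),
    bracket U (g • u) v = g • bracket U u v - derivAlong (onSec a U v) g • u

variable (n X) in
/-- A (holomorphic) Lie algebroid on a complex manifold. -/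
structure LieAlgebroid where
  sheaf : OMod n X
  reflexive : IsReflexive sheaf
  anchor : sheaf ⟶ tangentSheaf n X
  lie : LieStructure sheaf anchor

namespace LieStructure

variable {M : OMod n X} {a : M ⟶ tangentSheaf n X} (L : LieStructure M a)

lemma jacobi' {U : Opens X} (u v w : Sec M U) : L.bracket U u (L.bracket U v w) =
    L.bracket U (L.bracket U u v) w + L.bracket U v (L.bracket U u w) := by
  have h := L.jacobi u v w
  rw [L.skew u w, map_neg, L.skew (L.bracket U u v) w] at h
  rw [← sub_eq_zero, ← h]
  abel

lemma leibniz' {U : Opens X} (g : Hol n X U) (u v : Sec M U) :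
    L.bracket U u (g • v) = g • L.bracket U u v + derivAlong (onSec a U u) g • v := by
  rw [L.skew (g • v) u, L.leibniz, L.skew u v, smul_neg]
  abel

/-- A family of additive operators `ψ_W : M(W) → M(W)`, `W ⊆ U` open, together with a vector
field on `U`, is a Lie derivation of `M` over `U` which is a differential operator of order `≤ 1`
with this vector field as its symbol, if the `ψ_W` form a morphism of sheaves `M|_U → M|_U`, are
derivations of the bracket, and satisfy `ψ(f α) - f ψ(α) = (ψf) α` where `ψf` is the derivative of
`f` along the symbol. (In particular `ψ` is `ℂ`-linear.) -/
structure IsLieDer (U : Opens X)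
    (p : (∀ W : {W : Opens X // W ≤ U}, Sec M W.1 →+ Sec M W.1) × Sec (tangentSheaf n X) U) :
    Prop where
  op_res : ∀ (W W' : {W : Opens X // W ≤ U}) (h : W'.1 ≤ W.1) (α : Sec M W.1),
    p.1 W' (res M h α) = res M h (p.1 W α)
  op_bracket : ∀ (W : {W : Opens X // W ≤ U}) (α β : Sec M W.1),
    p.1 W (L.bracket W.1 α β) = L.bracket W.1 (p.1 W α) β + L.bracket W.1 α (p.1 W β)
  op_smul : ∀ (W : {W : Opens X // W ≤ U}) (f : Hol n X W.1) (α : Sec M W.1),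
    p.1 W (f • α) = f • p.1 W α + derivAlong (res (tangentSheaf n X) W.2 p.2) f • α

/-- The sections over `U` of `Der_Lie(M) ∩ D^{≤1}(M)`, each recorded with its symbol. -/
def lieDer (U : Opens X) : AddSubgroup
    ((∀ W : {W : Opens X // W ≤ U}, Sec M W.1 →+ Sec M W.1) × Sec (tangentSheaf n X) U) where
  carrier := {p | L.IsLieDer U p}
  zero_mem' :=
    { op_res := fun _ _ h _ => (map_zero (res M h)).symm
      op_bracket := fun W α β => by
        change 0 = L.bracket W.1 0 β + L.bracket W.1 α 0
        rw [map_zero, map_zero, AddMonoidHom.zero_apply, add_zero]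
      op_smul := fun W f α => by
        change 0 = f • 0 + derivAlong (res (tangentSheaf n X) W.2 0) f • α
        rw [map_zero, derivAlong_zero, smul_zero, zero_smul, add_zero] }
  add_mem' {p q} hp hq :=
    { op_res := fun W W' h α => by
        change p.1 W' _ + q.1 W' _ = res M h (p.1 W α + q.1 W α)
        rw [hp.op_res W W' h, hq.op_res W W' h, map_add]
      op_bracket := fun W α β => by
        change p.1 W _ + q.1 W _ =
          L.bracket W.1 (p.1 W α + q.1 W α) β + L.bracket W.1 α (p.1 W β + q.1 W β)
        rw [hp.op_bracket, hq.op_bracket, map_add, map_add, AddMonoidHom.add_apply]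
        abel
      op_smul := fun W f α => by
        change p.1 W _ + q.1 W _ = f • (p.1 W α + q.1 W α) +
          derivAlong (res (tangentSheaf n X) W.2 (p.2 + q.2)) f • α
        rw [hp.op_smul, hq.op_smul, map_add, derivAlong_add, smul_add, add_smul]
        abel }
  neg_mem' {p} hp :=
    { op_res := fun W W' h α => by
        change -p.1 W' _ = res M h (-p.1 W α)
        rw [hp.op_res W W' h, map_neg]
      op_bracket := fun W α β => by
        change -p.1 W _ = L.bracket W.1 (-p.1 W α) β + L.bracket W.1 α (-p.1 W β)
        rw [hp.op_bracket, map_neg, map_neg, AddMonoidHom.neg_apply]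
        abel
      op_smul := fun W f α => by
        change -p.1 W _ = f • (-p.1 W α) + derivAlong (res (tangentSheaf n X) W.2 (-p.2)) f • α
        rw [hp.op_smul, map_neg, derivAlong_neg, smul_neg, neg_smul]
        abel }

lemma lieDer_ext {U : Opens X} {p q : L.lieDer U}
    (h1 : ∀ (W : Opens X) (hW : W ≤ U) (α : Sec M W), p.1.1 ⟨W, hW⟩ α = q.1.1 ⟨W, hW⟩ α)
    (h2 : p.1.2 = q.1.2) : p = q :=
  Subtype.ext (Prod.ext (funext fun W => AddMonoidHom.ext fun α => h1 W.1 W.2 α) h2)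

/-- Restriction of first order Lie derivations. -/
def lieDerRes {U V : Opens X} (h : V ≤ U) : L.lieDer U →+ L.lieDer V where
  toFun p := ⟨(fun W => p.1.1 ⟨W.1, W.2.trans h⟩, res (tangentSheaf n X) h p.1.2),
    { op_res := fun W W' h' α => p.2.op_res ⟨W.1, W.2.trans h⟩ ⟨W'.1, W'.2.trans h⟩ h' α
      op_bracket := fun W α β => p.2.op_bracket ⟨W.1, W.2.trans h⟩ α β
      op_smul := fun W f α => by
        rw [pres_pres]
        exact p.2.op_smul ⟨W.1, W.2.trans h⟩ f α }⟩
  map_zero' := Subtype.ext (Prod.ext rfl (map_zero (res (tangentSheaf n X) h)))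
  map_add' p q := Subtype.ext (Prod.ext rfl (map_add (res (tangentSheaf n X) h) p.1.2 q.1.2))

/-- The presheaf `Der_Lie(M) ∩ D^{≤1}(M)`. -/
def lieDerPresheaf : TopCat.Presheaf AddCommGrpCat.{u} (TopCat.of X) where
  obj U := AddCommGrpCat.of (L.lieDer U.unop)
  map i := AddCommGrpCat.ofHom (L.lieDerRes i.unop.le)
  map_id _ := AddCommGrpCat.hom_ext (AddMonoidHom.ext fun p =>
    L.lieDer_ext (p := L.lieDerRes le_rfl p) (fun _ _ _ => rfl) (pres_self _ _ _))
  map_comp i j := AddCommGrpCat.hom_ext (AddMonoidHom.ext fun p =>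
    L.lieDer_ext (p := L.lieDerRes (j.unop.le.trans i.unop.le) p)
      (q := L.lieDerRes j.unop.le (L.lieDerRes i.unop.le p))
      (fun _ _ _ => rfl) (pres_pres _ _ _ _).symm)

lemma lieDerPresheaf_isSheaf : L.lieDerPresheaf.IsSheaf := by
  rw [TopCat.Presheaf.isSheaf_iff_isSheafUniqueGluing]
  intro ι V sf hsf
  let p (i : ι) : L.lieDer (V i) := sf i
  have hp (i j : ι) : L.lieDerRes (inf_le_left : V i ⊓ V j ≤ V i) (p i) =
      L.lieDerRes (inf_le_right : V i ⊓ V j ≤ V j) (p j) := hsf i j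
  have hop (i j : ι) (W : Opens X) (hi : W ≤ V i) (hj : W ≤ V j) (α : Sec M W) :
      (p i).1.1 ⟨W, hi⟩ α = (p j).1.1 ⟨W, hj⟩ α := by
    have := congrArg (fun q => q.1.1 ⟨W, le_inf hi hj⟩ α) (hp i j)
    exact this
  have hsymb (i j : ι) : res (tangentSheaf n X) (inf_le_left : V i ⊓ V j ≤ V i) (p i).1.2 =
      res (tangentSheaf n X) (inf_le_right : V i ⊓ V j ≤ V j) (p j).1.2 :=
    congrArg (fun q => q.1.2) (hp i j)
  obtain ⟨σ, hσ, hσu⟩ := sec_glue (tangentSheaf n X) V (le_iSup V) le_rfl (fun i => (p i).1.2) hsymb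
  have hcov (W : Opens X) (hW : W ≤ iSup V) : W ≤ ⨆ i, W ⊓ V i := by
    rw [← inf_iSup_eq]
    exact le_inf le_rfl hW
  have hglue (W : {W : Opens X // W ≤ iSup V}) (α : Sec M W.1) : ∃! β : Sec M W.1, ∀ i,
      res M (inf_le_left : W.1 ⊓ V i ≤ W.1) β =
        (p i).1.1 ⟨W.1 ⊓ V i, inf_le_right⟩ (res M inf_le_left α) := by
    refine sec_glue M (fun i => W.1 ⊓ V i) (fun i => inf_le_left) (hcov W.1 W.2) _ fun i j => ?_
    have hi := (p i).2.op_res ⟨W.1 ⊓ V i, inf_le_right⟩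
      ⟨(W.1 ⊓ V i) ⊓ (W.1 ⊓ V j), inf_le_left.trans inf_le_right⟩ inf_le_left
      (res M inf_le_left α)
    have hj := (p j).2.op_res ⟨W.1 ⊓ V j, inf_le_right⟩
      ⟨(W.1 ⊓ V i) ⊓ (W.1 ⊓ V j), inf_le_right.trans inf_le_right⟩ inf_le_right
      (res M inf_le_left α)
    rw [pres_pres] at hi hj
    exact hi.symm.trans ((hop i j _ _ _ _).trans hj)
  choose ψ hψ hψu using hglue
  have huniq (W : {W : Opens X // W ≤ iSup V}) (β β' : Sec M W.1)
      (h : ∀ i, res M (inf_le_left : W.1 ⊓ V i ≤ W.1) β = res M inf_le_left β') : β = β' :=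
    sec_ext M (fun i => W.1 ⊓ V i) (fun i => inf_le_left) (hcov W.1 W.2) β β' h
  let ψh (W : {W : Opens X // W ≤ iSup V}) : Sec M W.1 →+ Sec M W.1 :=
    AddMonoidHom.mk' (ψ W) fun α β => huniq W _ _ fun i => by
      rw [hψ, map_add, map_add, map_add, hψ, hψ]
  have hder : L.IsLieDer (iSup V) (ψh, σ) :=
    { op_res := fun W W' h α => huniq W' _ _ fun i => by
        have h1 := hψ W' (res M h α) i
        have h2 := congrArg (res M (inf_le_inf_right (V i) h)) (hψ W α i)
        rw [pres_pres] at h1 h2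
        change res M _ (ψ W' (res M h α)) = res M _ (res M h (ψ W α))
        rw [h1, pres_pres, h2]
        have h3 := (p i).2.op_res ⟨W.1 ⊓ V i, inf_le_right⟩ ⟨W'.1 ⊓ V i, inf_le_right⟩
          (inf_le_inf_right (V i) h) (res M inf_le_left α)
        rw [pres_pres] at h3
        exact h3
      op_bracket := fun W α β => huniq W _ _ fun i => by
        change res M _ (ψ W _) = res M _ (L.bracket _ (ψ W α) β + L.bracket _ α (ψ W β))
        rw [hψ, ← L.bracket_res, (p i).2.op_bracket, map_add, ← L.bracket_res, ← L.bracket_res,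
          hψ, hψ]
      op_smul := fun W f α => huniq W _ _ fun i => by
        change res M _ (ψ W _) = res M _ (f • ψ W α +
          derivAlong (res (tangentSheaf n X) W.2 σ) f • α)
        rw [hψ, pres_smul, (p i).2.op_smul, map_add, pres_smul, pres_smul, hψ, ← derivAlong_res,
          pres_pres, ← hσ i, pres_pres] }
  refine ⟨(⟨(ψh, σ), hder⟩ : L.lieDer (iSup V)), fun i => ?_, fun q hq => ?_⟩
  · refine L.lieDer_ext (fun W hW α => ?_) (hσ i)
    have hWi : W ≤ W ⊓ V i := le_inf le_rfl hW
    have h1 := congrArg (res M hWi) (hψ ⟨W, hW.trans (le_iSup V i)⟩ α i)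
    rw [pres_pres, pres_self] at h1
    have h2 := (p i).2.op_res ⟨W ⊓ V i, inf_le_right⟩ ⟨W, hW⟩ hWi (res M inf_le_left α)
    rw [pres_pres, pres_self] at h2
    exact h1.trans h2.symm
  · let q' : L.lieDer (iSup V) := q
    have hq' (i : ι) : L.lieDerRes (le_iSup V i) q' = p i := hq i
    refine L.lieDer_ext (p := q') (fun W hW α => ?_)
      (hσu q'.1.2 fun i => congrArg (fun r => r.1.2) (hq' i))
    refine hψu ⟨W, hW⟩ α (q'.1.1 ⟨W, hW⟩ α) fun i => ?_
    rw [← hq' i, ← q'.2.op_res ⟨W, hW⟩ ⟨W ⊓ V i, inf_le_left.trans hW⟩ inf_le_left α]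
    rfl

/-- The sheaf `Der_Lie(M) ∩ D^{≤1}(M)` of Lie derivations of `M` that are differential operators
of order `≤ 1`. -/
def lieDerSheaf : TopCat.Sheaf AddCommGrpCat.{u} (TopCat.of X) :=
  ⟨L.lieDerPresheaf, L.lieDerPresheaf_isSheaf⟩

/-- The symbol map `σ : Der_Lie(M) ∩ D^{≤1}(M) → T_X`. -/
def symbolMap : L.lieDerSheaf ⟶ ab (tangentSheaf n X) where
  hom :=
    { app U := AddCommGrpCat.ofHom
        { toFun p := (p : L.lieDer U.unop).1.2
          map_zero' := rfl
          map_add' _ _ := rfl }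
      naturality _ _ _ := rfl }

/-- The derivation `{α, -}`, whose symbol is `a(α)`. -/
def adSec {U : Opens X} (α : Sec M U) : L.lieDer U :=
  ⟨(fun W => L.bracket W.1 (res M W.2 α), onSec a U α),
    { op_res := fun W W' h β => by
        change L.bracket W'.1 (res M W'.2 α) (res M h β) = res M h (L.bracket W.1 (res M W.2 α) β)
        rw [← L.bracket_res, pres_pres]
      op_bracket := fun W β γ => L.jacobi' _ β γ
      op_smul := fun W f β => by
        change L.bracket W.1 (res M W.2 α) (f • β) = _
        rw [L.leibniz', onSec_res] }⟩

lemma adSec_add {U : Opens X} (α α' : Sec M U) : L.adSec (α + α') = L.adSec α + L.adSec α' :=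
  L.lieDer_ext (fun W hW β => by
    change L.bracket W (res M hW (α + α')) β =
      L.bracket W (res M hW α) β + L.bracket W (res M hW α') β
    rw [map_add, map_add, AddMonoidHom.add_apply]) (map_add (onSec a U) α α')

lemma adSec_res {U V : Opens X} (h : V ≤ U) (α : Sec M U) :
    L.adSec (res M h α) = L.lieDerRes h (L.adSec α) :=
  L.lieDer_ext (fun W hW β => by
    change L.bracket W (res M hW (res M h α)) β = L.bracket W (res M (hW.trans h) α) β
    rw [pres_pres]) (onSec_res a h α)

/-- The map `M → Der_Lie(M) ∩ D^{≤1}(M)`, `α ↦ {α, -}`. -/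
def ad : ab M ⟶ L.lieDerSheaf where
  hom :=
    { app U := AddCommGrpCat.ofHom
        (AddMonoidHom.mk' (fun α : Sec M U.unop => L.adSec α) L.adSec_add :
          Sec M U.unop →+ L.lieDer U.unop)
      naturality _ _ i := AddCommGrpCat.hom_ext (AddMonoidHom.ext fun α =>
        L.adSec_res i.unop.le α) }

lemma ad_symbolMap : L.ad ≫ L.symbolMap = abMap a := rfl

end LieStructure

end Structures

section Unfoldings

variable {n m : ℕ} {X S : Type u}
  [TopologicalSpace X] [ChartedSpace (Cn n) X] [IsManifold 𝓘(ℂ, Cn n) ω X]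
  [TopologicalSpace S] [ChartedSpace (Cn m) S] [IsManifold 𝓘(ℂ, Cn m) ω S] {π : X → S}

/-- A family of (singular holomorphic) Lie algebroids over a smooth morphism `π : X → S`. -/
structure LieFamily (hπ : IsSmoothMorphism n m π) where
  sheaf : OMod n X
  reflexive : IsReflexive sheaf
  flat : IsFlatOver hπ sheaf
  anchor : sheaf ⟶ relTangent n m π
  lie : LieStructure sheaf (anchor ≫ relTangentIncl n m π)

namespace LieFamily

variable {hπ : IsSmoothMorphism n m π} (AS : LieFamily hπ)

lemma ad_differential :
    AS.lie.ad ≫ AS.lie.symbolMap ≫ abMap (differential hπ) = 0 := by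
  have h : (AS.anchor ≫ relTangentIncl n m π) ≫ differential hπ = 0 := by
    rw [Category.assoc, relTangentIncl_differential, comp_zero]
  rw [← Category.assoc, LieStructure.ad_symbolMap]
  exact (Functor.map_comp (SheafOfModules.toSheaf (ringSheaf n X)) _ _).symm.trans
    ((congrArg _ h).trans (Functor.map_zero _ _ _))

/-- The map `(Der_Lie(A_S) ∩ D^{≤1}(A_S)) / A_S → π^*T_S` induced by the symbol. -/
def quotSymbol : cokernel AS.lie.ad ⟶ ab (pullbackTangent hπ) :=
  cokernel.desc AS.lie.ad (AS.lie.symbolMap ≫ abMap (differential hπ)) AS.ad_differential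

/-- The sheaf `𝔲(A_S) = σ⁻¹(π⁻¹T_S) ⊆ (Der_Lie(A_S) ∩ D^{≤1}(A_S)) / A_S`. -/
def frakU : TopCat.Sheaf AddCommGrpCat.{u} (TopCat.of X) := pullback AS.quotSymbol (basicIncl hπ)

/-- The inclusion `𝔲(A_S) → (Der_Lie(A_S) ∩ D^{≤1}(A_S)) / A_S`. -/
def frakUIncl : AS.frakU ⟶ cokernel AS.lie.ad := pullback.fst AS.quotSymbol (basicIncl hπ)

/-- The symbol map `𝔲(A_S) → π⁻¹T_S`. -/
def frakUSymbol : AS.frakU ⟶ basicSheaf m π := pullback.snd AS.quotSymbol (basicIncl hπ)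

end LieFamily

/-- An unfolding of a family `A_S`: a Lie algebroid `A` on `X` containing `A_S` (with its anchor and
bracket) as `a⁻¹(Im a_S)`, with `rank A = rank A_S + dim S`. -/
structure Unfolding {hπ : IsSmoothMorphism n m π} (AS : LieFamily hπ) extends LieAlgebroid n X where
  /-- the inclusion `A_S → A` -/
  incl : AS.sheaf ⟶ sheaf
  incl_injective : ∀ U : Opens X, Function.Injective (onSec incl U)
  incl_anchor : incl ≫ anchor = AS.anchor ≫ relTangentIncl n m π
  incl_bracket : ∀ {U : Opens X} (α β : Sec AS.sheaf U),
    onSec incl U (AS.lie.bracket U α β) = lie.bracket U (onSec incl U α) (onSec incl U β)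
  mem_range_incl : ∀ {U : Opens X} (s : Sec sheaf U), s ∈ Set.range (onSec incl U) ↔
    ∀ x ∈ U, ∃ (V : Opens X) (_ : x ∈ V) (h : V ≤ U) (γ : Sec AS.sheaf V),
      onSec (AS.anchor ≫ relTangentIncl n m π) V γ = onSec anchor V (res sheaf h s)
  rank_eq : ∀ x : X, rankAt sheaf x = rankAt AS.sheaf x + m

namespace Unfolding

variable {hπ : IsSmoothMorphism n m π} {AS : LieFamily hπ} (A : Unfolding AS)

/-- The map `N_S A = coker (a_S) → N A = coker a` induced by the inclusions `A_S → A` and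
`T_{X|S} → T_X`. -/
def normalMap : cokernel AS.anchor ⟶ cokernel A.anchor :=
  cokernel.map AS.anchor A.anchor A.incl (relTangentIncl n m π) A.incl_anchor.symm

/-- An unfolding is transversal if `N_S A → N A` is an isomorphism. -/
def IsTransversal : Prop := IsIso A.normalMap

lemma incl_anchor_differential : A.incl ≫ A.anchor ≫ differential hπ = 0 := by
  rw [← Category.assoc, A.incl_anchor, Category.assoc, relTangentIncl_differential, comp_zero]

/-- The map `[a] : A / A_S → π^*T_S` induced by the anchor. -/
def anchorQuot : cokernel A.incl ⟶ pullbackTangent hπ :=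
  cokernel.desc A.incl (A.anchor ≫ differential hπ) A.incl_anchor_differential

end Unfolding

end Unfoldings

end Algebroids


end
end HolAlgebroid

open HolAlgebroid

/-! Transversality forces $\mathcal A_S=\ker(\mathcal A\to\pi^*T_S)$: if $a(s)$ is vertical, its
class in $\mathrm{Coker}(a_S)$ dies in $\mathrm{Coker}(a)$, hence is already zero, so $a(s)$ lies
locally in $\mathrm{Im}\,a_S$ and $s\in a^{-1}(\mathrm{Im}\,a_S)=\mathcal A_S$
(`IsTransversal.mem_range_incl_iff`). This makes $[a]$ a monomorphism. It is an epimorphism because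
$\mathrm{Coker}(a_S)\to\mathrm{Coker}(a)$ is one and so is $d\pi$ (`epi_differential`); see
`IsTransversal.isIso_anchorQuot`.

Let $s$ project to a basic field $Z$ and let $\alpha\in\mathcal A_S$. By the kernel description,
$\{\alpha,s\}\in\mathcal A_S$ as soon as $a(\{\alpha,s\})$ kills every $h\circ\pi$
(`differential_anchor_bracket_eq_zero`). Compatibility of the anchor with brackets is not an axiom,
but Jacobi and Leibniz give it after multiplication by any section $\beta$ of $\mathcal A$. Since
$a(\alpha)$ kills both $h\circ\pi$ and $a(s)(h\circ\pi)=Z(h)\circ\pi$, this yields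
$a(\{\alpha,s\})(h\circ\pi)\,\beta=0$. If $\dim S>0$, the rank of $\mathcal A$ is positive, so some
germ $\beta$ has zero annihilator and the coefficient vanishes; if $\dim S=0$ there is nothing to
prove.

Hence $\{s,-\}$ is a derivation of $\mathcal A_S$ with symbol $a(s)$, and changing $s$ by $\mathcal
A_S$ changes it by an inner derivation. Lifts of $Z$ exist only locally, so the construction is made
on the sheaf of pairs $(s,Z)$ and descended along the epimorphism $(s,Z)\mapsto Z$ (`basicToQuot`).
The symbol of the result is $Z$, which gives both the map into $\mathfrak u(\mathcal A_S)$ and its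
injectivity. -/

namespace HolAlgebroid

noncomputable section

/-! ### Sections of sheaves of modules: cokernels, monomorphisms and epimorphisms seen locally. -/

section LocalExactness

variable {n : ℕ} {X : Type u} [TopologicalSpace X] [ChartedSpace (Cn n) X]

lemma onSec_comp {M N K : OMod n X} (φ : M ⟶ N) (ψ : N ⟶ K) (U : Opens X) (s : Sec M U) :
    onSec (φ ≫ ψ) U s = onSec ψ U (onSec φ U s) := rfl

lemma onSec_zero {M N : OMod n X} (U : Opens X) (s : Sec M U) :
    onSec (0 : M ⟶ N) U s = 0 := rfl

lemma onSec_congr {M N : OMod n X} {φ ψ : M ⟶ N} (h : φ = ψ) (U : Opens X) (s : Sec M U) :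
    onSec φ U s = onSec ψ U s := by rw [h]

lemma hom_ext_onSec {M N : OMod n X} {φ ψ : M ⟶ N}
    (h : ∀ (U : Opens X) (s : Sec M U), onSec φ U s = onSec ψ U s) : φ = ψ :=
  SheafOfModules.hom_ext (PresheafOfModules.hom_ext fun U =>
    ModuleCat.hom_ext (LinearMap.ext fun s => h U.unop s))

/-- A section killed by the map to the cokernel lifts locally. -/
lemma exists_local_preimage_of_cokernel {M N : OMod n X} (φ : M ⟶ N) {U : Opens X} (t : Sec N U)
    (ht : onSec (cokernel.π φ) U t = 0) {x : X} (hx : x ∈ U) :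
    ∃ (V : Opens X) (_ : x ∈ V) (h : V ≤ U) (s : Sec M V), onSec φ V s = res N h t := by
  -- The sheafified presheaf cokernel `C` also receives a map `q` from `N` that kills `φ`, so `t`
  -- dies there. Then its class in `C` vanishes on a smaller open set, where exactness can be
  -- evaluated on sections.
  let adj := PresheafOfModules.sheafificationAdjunction (𝟙 (ringSheaf n X).obj)
  let C : PMod n X := cokernel φ.val
  let q : N ⟶ (PresheafOfModules.sheafification (𝟙 (ringSheaf n X).obj)).obj C :=
    ⟨cokernel.π φ.val ≫ adj.unit.app C⟩
  have hq : φ ≫ q = 0 := by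
    refine SheafOfModules.hom_ext ?_
    change φ.val ≫ cokernel.π φ.val ≫ adj.unit.app C = 0
    rw [← Category.assoc, cokernel.condition, zero_comp]
  have h1 : onSec q U t = 0 := by
    rw [← cokernel.π_desc φ q hq, onSec_comp, ht, map_zero]
  let c : PSec C U := ((cokernel.π φ.val).app (op U)).hom t
  have h2 : (CategoryTheory.toSheafify (Opens.grothendieckTopology (TopCat.of X)) C.presheaf).app
      (op U) c = (CategoryTheory.toSheafify (Opens.grothendieckTopology (TopCat.of X))
        C.presheaf).app (op U) 0 := h1.trans (map_zero _).symm
  obtain ⟨V, i, hi, hxV⟩ := CategoryTheory.Presheaf.equalizerSieve_mem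
    (Opens.grothendieckTopology (TopCat.of X)) _ _ _ h2 x hx
  have h3 : ((cokernel.π φ.val).app (op V)).hom (res N i.le t) = 0 :=
    (PresheafOfModules.naturality_apply (cokernel.π φ.val) i.op t).trans
      (hi.trans (map_zero (C.presheaf.map i.op).hom))
  have hex := (ShortComplex.exact_cokernel φ.val).map
    (PresheafOfModules.evaluation (ringSheaf n X).obj (op V))
  rw [ShortComplex.moduleCat_exact_iff] at hex
  obtain ⟨s, hs⟩ := hex (res N i.le t) h3
  exact ⟨V, hxV, i.le, s, hs⟩

lemma exists_local_preimage_of_epi {M N : OMod n X} (φ : M ⟶ N) [Epi φ] {U : Opens X}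
    (t : Sec N U) {x : X} (hx : x ∈ U) :
    ∃ (V : Opens X) (_ : x ∈ V) (h : V ≤ U) (s : Sec M V), onSec φ V s = res N h t :=
  exists_local_preimage_of_cokernel φ t (onSec_congr (cokernel.π_of_epi φ) U t) hx

lemma sec_eq_zero_of_locally {M : OMod n X} {U : Opens X} (s : Sec M U)
    (hs : ∀ x ∈ U, ∃ (V : Opens X) (_ : x ∈ V) (h : V ≤ U), res M h s = 0) : s = 0 := by
  choose V hxV hVU hV using hs
  refine sec_ext M (fun x : U => V x.1 x.2) (fun x => hVU x.1 x.2) (fun x hx => ?_) s 0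
    fun x => (hV x.1 x.2).trans (map_zero _).symm
  exact Opens.mem_iSup.2 ⟨⟨x, hx⟩, hxV x hx⟩

lemma epi_of_local_preimage {M N : OMod n X} (φ : M ⟶ N)
    (h : ∀ (U : Opens X) (t : Sec N U), ∀ x ∈ U,
      ∃ (V : Opens X) (_ : x ∈ V) (h : V ≤ U) (s : Sec M V), onSec φ V s = res N h t) : Epi φ := by
  refine Preadditive.epi_of_cancel_zero φ fun {K} ψ hψ => ?_
  refine hom_ext_onSec fun U t => sec_eq_zero_of_locally _ fun x hx => ?_
  obtain ⟨V, hxV, hV, s, hs⟩ := h U t x hx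
  refine ⟨V, hxV, hV, ?_⟩
  rw [← onSec_res, ← hs, ← onSec_comp, hψ, onSec_zero]

lemma mono_of_injective_onSec {M N : OMod n X} (φ : M ⟶ N)
    (h : ∀ (U : Opens X) (s : Sec M U), onSec φ U s = 0 → s = 0) : Mono φ := by
  refine Preadditive.mono_of_cancel_zero φ fun {K} ψ hψ => ?_
  exact hom_ext_onSec fun U t => h U (onSec ψ U t) (by rw [← onSec_comp, hψ, onSec_zero])

lemma onSec_injective_of_isIso {M N : OMod n X} (φ : M ⟶ N) [IsIso φ] (U : Opens X) :
    Function.Injective (onSec φ U) :=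
  Function.LeftInverse.injective (g := onSec (inv φ) U) fun s => by
    rw [← onSec_comp, IsIso.hom_inv_id]
    rfl

lemma onSec_cokernel_π_onSec {M N : OMod n X} (φ : M ⟶ N) (U : Opens X) (s : Sec M U) :
    onSec (cokernel.π φ) U (onSec φ U s) = 0 := by
  rw [← onSec_comp, cokernel.condition, onSec_zero]

end LocalExactness

/-! ### Transversality: the kernel of the projected anchor, and invertibility of $[a]$. -/

section Transversal

variable {n m : ℕ} {X S : Type u}
  [TopologicalSpace X] [ChartedSpace (Cn n) X] [IsManifold 𝓘(ℂ, Cn n) ω X]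
  [TopologicalSpace S] [ChartedSpace (Cn m) S] [IsManifold 𝓘(ℂ, Cn m) ω S] {π : X → S}
  {hπ : IsSmoothMorphism n m π}

lemma exists_relTangent_of_differential_eq_zero {U : Opens X} (v : Sec (tangentSheaf n X) U)
    (hv : onSec (differential hπ) U v = 0) :
    ∃ t : Sec (relTangent n m π) U, onSec (relTangentIncl n m π) U t = v := by
  let v' : (alongSheaf (contMDiff_id (M := X))).sec U := v
  have hv' (x : U) : mfderiv 𝓘(ℂ, Cn n) 𝓘(ℂ, Cn m) π x.1 (v'.1 x) = 0 :=
    congrArg (fun w : (alongSheaf hπ.contMDiff).sec U => w.1 x) hv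
  exact ⟨(⟨v'.1, v'.2, hv'⟩ : (verticalFib n m π).sec U), rfl⟩

namespace Unfolding

variable {AS : LieFamily hπ} (A : Unfolding AS)

lemma onSec_anchor_onSec_incl {U : Opens X} (α : Sec AS.sheaf U) :
    onSec A.anchor U (onSec A.incl U α) = onSec (AS.anchor ≫ relTangentIncl n m π) U α :=
  onSec_congr A.incl_anchor U α

variable {A} in
/-- For a transversal unfolding, `A_S` is the kernel of `A → π^*T_S`. -/
lemma IsTransversal.mem_range_incl_iff (hA : A.IsTransversal) {U : Opens X} (s : Sec A.sheaf U) :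
    s ∈ Set.range (onSec A.incl U) ↔ onSec (A.anchor ≫ differential hπ) U s = 0 := by
  constructor
  · rintro ⟨α, rfl⟩
    exact onSec_congr A.incl_anchor_differential U α
  · intro hs
    have : IsIso A.normalMap := hA
    rw [A.mem_range_incl]
    intro x hx
    -- The field $a(s)$ is vertical, hence a section `t` of $T_{X|S}$. Its class in
    -- $\mathrm{Coker}(a_S)$ vanishes by injectivity of `normalMap`, since its image in
    -- $\mathrm{Coker}(a)$ is the class of $a(s)$.
    obtain ⟨t, ht⟩ := exists_relTangent_of_differential_eq_zero (hπ := hπ) (onSec A.anchor U s) hs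
    have h1 : onSec (cokernel.π AS.anchor) U t = 0 := by
      refine onSec_injective_of_isIso A.normalMap U ?_
      have h2 : cokernel.π AS.anchor ≫ A.normalMap =
          relTangentIncl n m π ≫ cokernel.π A.anchor := cokernel.π_desc _ _ _
      rw [map_zero, ← onSec_comp, h2, onSec_comp, ht, onSec_cokernel_π_onSec]
    obtain ⟨V, hxV, hV, γ, hγ⟩ := exists_local_preimage_of_cokernel AS.anchor t h1 hx
    refine ⟨V, hxV, hV, γ, ?_⟩
    rw [onSec_comp, hγ, onSec_res, ht, onSec_res]

variable {A} in
-- A section with zero class in $\mathcal A/\mathcal A_S$ has zero image under $[a]$, so the kernel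
-- description applies and no gluing of local preimages is needed.
lemma IsTransversal.mem_range_incl_iff_cokernel (hA : A.IsTransversal) {U : Opens X}
    (s : Sec A.sheaf U) :
    s ∈ Set.range (onSec A.incl U) ↔ onSec (cokernel.π A.incl) U s = 0 := by
  constructor
  · rintro ⟨α, rfl⟩
    exact onSec_cokernel_π_onSec A.incl U α
  · intro hs
    rw [hA.mem_range_incl_iff]
    have h : cokernel.π A.incl ≫ A.anchorQuot = A.anchor ≫ differential hπ :=
      cokernel.π_desc _ _ _
    rw [← h, onSec_comp, hs, map_zero]

variable {A} in
-- Injectivity of $\mathrm{Coker}(a_S)\to\mathrm{Coker}(a)$ gives the monomorphism, through the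
-- kernel description; its surjectivity, with that of $d\pi$, gives the epimorphism.
lemma IsTransversal.isIso_anchorQuot (hA : A.IsTransversal) [Epi (differential hπ)] :
    IsIso A.anchorQuot := by
  have : IsIso A.normalMap := hA
  have hq : cokernel.π A.incl ≫ A.anchorQuot = A.anchor ≫ differential hπ := cokernel.π_desc _ _ _
  have h1 : Mono A.anchorQuot := by
    refine mono_of_injective_onSec _ fun U c hc => sec_eq_zero_of_locally c fun x hx => ?_
    obtain ⟨V, hxV, hV, s, hs⟩ := exists_local_preimage_of_epi (cokernel.π A.incl) c hx
    refine ⟨V, hxV, hV, ?_⟩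
    rw [← hs, ← hA.mem_range_incl_iff_cokernel, hA.mem_range_incl_iff, ← hq, onSec_comp, hs,
      onSec_res, hc, map_zero]
  have h2 : Epi A.anchorQuot := by
    refine Preadditive.epi_of_cancel_zero _ fun {K} g hg => ?_
    -- If `g` kills the image of $[a]$, then $d\pi$ followed by `g` factors through
    -- $\mathrm{Coker}(a)$. The factor vanishes because it does so on classes of vertical fields,
    -- and these generate by transversality.
    have h3 : A.anchor ≫ differential hπ ≫ g = 0 := by
      rw [← Category.assoc, ← hq, Category.assoc, hg, comp_zero]
    have h4 : cokernel.π AS.anchor ≫ A.normalMap =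
        relTangentIncl n m π ≫ cokernel.π A.anchor := cokernel.π_desc _ _ _
    have h5 : cokernel.desc A.anchor _ h3 = 0 := by
      rw [← cancel_epi A.normalMap, ← cancel_epi (cokernel.π AS.anchor), ← Category.assoc, h4,
        Category.assoc, cokernel.π_desc, ← Category.assoc, relTangentIncl_differential, zero_comp,
        comp_zero, comp_zero]
    rw [← cancel_epi (differential hπ), ← cokernel.π_desc A.anchor _ h3, h5, comp_zero, comp_zero]
  exact isIso_of_mono_of_epi _

end Unfolding

end Transversal

/-! ### Surjectivity of the differential of a submersion. -/

section Submersions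

variable {n m : ℕ} {X S : Type u}
  [TopologicalSpace X] [ChartedSpace (Cn n) X] [IsManifold 𝓘(ℂ, Cn n) ω X]
  [TopologicalSpace S] [ChartedSpace (Cn m) S] [IsManifold 𝓘(ℂ, Cn m) ω S] {π : X → S}

/-- The lifting argument pushes forward vector fields along a map rather than on a manifold, and by
charts, which are holomorphic only on their domains. -/
lemma contMDiff_tangentMap_comp {E₁ H₁ N₁ E₂ H₂ N₂ E₃ H₃ N₃ : Type*}
    [NormedAddCommGroup E₁] [NormedSpace ℂ E₁] [TopologicalSpace H₁]
    {I₁ : ModelWithCorners ℂ E₁ H₁} [TopologicalSpace N₁] [ChartedSpace H₁ N₁]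
    [NormedAddCommGroup E₂] [NormedSpace ℂ E₂] [TopologicalSpace H₂]
    {I₂ : ModelWithCorners ℂ E₂ H₂} [TopologicalSpace N₂] [ChartedSpace H₂ N₂]
    [IsManifold I₂ ω N₂]
    [NormedAddCommGroup E₃] [NormedSpace ℂ E₃] [TopologicalSpace H₃]
    {I₃ : ModelWithCorners ℂ E₃ H₃} [TopologicalSpace N₃] [ChartedSpace H₃ N₃]
    [IsManifold I₃ ω N₃] {U : Set N₂} (hU : IsOpen U) {f : N₂ → N₃}
    (hf : ContMDiffOn I₂ I₃ ω f U) {g : N₁ → N₂} {v : ∀ x, TangentSpace I₂ (g x)}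
    (hv : ContMDiff I₁ I₂.tangent ω (fun x => (⟨g x, v x⟩ : TangentBundle I₂ N₂)))
    (hg : ∀ x, g x ∈ U) :
    ContMDiff I₁ I₃.tangent ω
      (fun x => (⟨f (g x), mfderiv I₂ I₃ f (g x) (v x)⟩ : TangentBundle I₃ N₃)) := by
  have h1 := hf.contMDiffOn_tangentMapWithin (m := ω) le_rfl hU.uniqueMDiffOn
  have h2 : ContMDiff I₁ I₃.tangent ω (fun x =>
      tangentMapWithin I₂ I₃ f U (⟨g x, v x⟩ : TangentBundle I₂ N₂)) :=
    h1.comp_contMDiff hv hg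
  convert h2 using 2 with x
  simp only [tangentMapWithin, mfderivWithin_of_isOpen hU (hg x)]

lemma mdifferentiable_of_mem_maximalAtlas {k : ℕ} {M : Type*} [TopologicalSpace M]
    [ChartedSpace (Cn k) M] [IsManifold 𝓘(ℂ, Cn k) ω M] {e : OpenPartialHomeomorph M (Cn k)}
    (he : e ∈ IsManifold.maximalAtlas 𝓘(ℂ, Cn k) ω M) :
    e.MDifferentiable 𝓘(ℂ, Cn k) 𝓘(ℂ, Cn k) :=
  ⟨(contMDiffOn_of_mem_maximalAtlas he).mdifferentiableOn (by simp),
    (contMDiffOn_symm_of_mem_maximalAtlas he).mdifferentiableOn (by simp)⟩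

lemma contMDiff_totalSpace_modelSpace {E₁ H₁ N₁ E : Type*}
    [NormedAddCommGroup E₁] [NormedSpace ℂ E₁] [TopologicalSpace H₁]
    {I₁ : ModelWithCorners ℂ E₁ H₁} [TopologicalSpace N₁] [ChartedSpace H₁ N₁]
    [NormedAddCommGroup E] [NormedSpace ℂ E] {g w : N₁ → E}
    (hg : ContMDiff I₁ 𝓘(ℂ, E) ω g) (hw : ContMDiff I₁ 𝓘(ℂ, E) ω w) :
    ContMDiff I₁ 𝓘(ℂ, E).tangent ω (fun x => (⟨g x, w x⟩ : TangentBundle 𝓘(ℂ, E) E)) := by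
  intro x
  rw [Bundle.contMDiffAt_totalSpace]
  refine ⟨hg x, ?_⟩
  convert! hw x with y
  simp

/-- Vector fields along a submersion lift locally. -/
lemma exists_local_lift (hπ : IsSmoothMorphism n m π) {U : Opens X}
    (t : ∀ x : U, TangentSpace 𝓘(ℂ, Cn m) (π x)) (ht : IsHolAlong n m π U t) {x : X} (hx : x ∈ U) :
    ∃ (V : Opens X) (_ : x ∈ V) (h : V ≤ U) (v : ∀ x : V, TangentSpace 𝓘(ℂ, Cn n) (id x.1)),
      IsHolAlong n n id V v ∧
        ∀ y : V, mfderiv 𝓘(ℂ, Cn n) 𝓘(ℂ, Cn m) π y.1 (v y) = t ⟨y.1, h y.2⟩ := by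
  have hs := hπ.isSubmersionAt x
  let φ := hs.domChart
  let ψ := hs.codChart
  let e := hs.equiv
  have hφ := hs.domChart_mem_maximalAtlas
  have hψ := hs.codChart_mem_maximalAtlas
  have hφd : φ.MDifferentiable _ _ := mdifferentiable_of_mem_maximalAtlas hφ
  have hψd : ψ.MDifferentiable _ _ := mdifferentiable_of_mem_maximalAtlas hψ
  have hsrc : ∀ y ∈ φ.source, π y ∈ ψ.source := hs.source_subset_preimage_source
  have hloc : ∀ y ∈ φ.source, ψ (π y) = (e (φ y)).1 := fun y hy => by
    have h := (fun h => hs.writtenInCharts h : φ y ∈ (hs.domChart.extend 𝓘(ℂ, Cn n)).target → _) (by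
      rw [OpenPartialHomeomorph.extend_target]
      simpa using φ.map_source hy)
    have h' : ψ (π (φ.symm (φ y))) = (e (φ y)).1 := h
    rwa [φ.left_inv hy] at h'
  -- In submersion charts $\pi$ becomes the linear projection `P`, with linear section `R`. The lift
  -- of `t` is obtained by reading `t` in the chart of $S$, applying `R`, and returning through the
  -- inverse chart of $X$.
  let V : Opens X := ⟨φ.source, φ.open_source⟩ ⊓ U
  let P : Cn n →L[ℂ] Cn m := (ContinuousLinearMap.fst ℂ (Cn m) hs.complement).comp
    (e : Cn n →L[ℂ] _)
  let R : Cn m →L[ℂ] Cn n :=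
    (e.symm : _ →L[ℂ] Cn n).comp (ContinuousLinearMap.inl ℂ (Cn m) hs.complement)
  have hPR (z : Cn m) : P (R z) = z := by simp [P, R]
  let w (y : V) : Cn m := mfderiv 𝓘(ℂ, Cn m) 𝓘(ℂ, Cn m) ψ (π y.1) (t ⟨y.1, y.2.2⟩)
  have hw : ContMDiff 𝓘(ℂ, Cn n) 𝓘(ℂ, Cn m) ω w :=
    (contMDiff_snd_tangentBundle_modelSpace (Cn m) 𝓘(ℂ, Cn m)).comp
      (contMDiff_tangentMap_comp ψ.open_source (contMDiffOn_of_mem_maximalAtlas hψ)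
        (ht.restrict (inf_le_right : V ≤ U)) fun y => hsrc y.1 y.2.1)
  have hRw : ContMDiff 𝓘(ℂ, Cn n) 𝓘(ℂ, Cn n) ω (fun y : V => R (w y)) :=
    R.contMDiff.comp hw
  have hφV : ContMDiff 𝓘(ℂ, Cn n) 𝓘(ℂ, Cn n) ω (fun y : V => φ y.1) :=
    (contMDiffOn_of_mem_maximalAtlas hφ).comp_contMDiff contMDiff_subtype_val fun y => y.2.1
  have hv := contMDiff_tangentMap_comp φ.open_target (contMDiffOn_symm_of_mem_maximalAtlas hφ)
    (contMDiff_totalSpace_modelSpace hφV hRw) fun y => φ.map_source y.2.1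
  refine ⟨V, ⟨hs.mem_domChart_source, hx⟩, inf_le_right,
    fun y => mfderiv 𝓘(ℂ, Cn n) 𝓘(ℂ, Cn n) φ.symm (φ y.1) (R (w y)), ?_, fun y => ?_⟩
  -- The base point produced by the construction is `φ.symm (φ y)`, which must be replaced by `y` in
  -- the total space, where the two sides have a common type.
  · have hb (y : V) : (⟨φ.symm (φ y.1), mfderiv 𝓘(ℂ, Cn n) 𝓘(ℂ, Cn n) φ.symm (φ y.1) (R (w y))⟩ :
        TangentBundle 𝓘(ℂ, Cn n) X) =
        ⟨id y.1, mfderiv 𝓘(ℂ, Cn n) 𝓘(ℂ, Cn n) φ.symm (φ y.1) (R (w y))⟩ := by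
      refine congrArg (fun z => (⟨z, _⟩ : TangentBundle 𝓘(ℂ, Cn n) X)) (φ.left_inv y.2.1)
    exact hv.congr fun y => (hb y).symm
  · have hy := y.2.1
    -- It suffices to compare after $d\psi$. There $d\psi\circ d\pi=P\circ d\varphi$ by the chain
    -- rule, $d\varphi$ cancels the derivative of its inverse, and $PR=1$.
    refine hψd.mfderiv_injective (hsrc y.1 hy) ?_
    have hπy : MDifferentiableAt 𝓘(ℂ, Cn n) 𝓘(ℂ, Cn m) π y.1 :=
      (hπ.contMDiff y.1).mdifferentiableAt (by simp)
    have h1 := mfderiv_comp y.1 (hψd.mdifferentiableAt (hsrc y.1 hy)) hπy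
    have hP : MDifferentiableAt 𝓘(ℂ, Cn n) 𝓘(ℂ, Cn m) P (φ y.1) := P.mdifferentiableAt
    have h2 := mfderiv_comp y.1 hP (hφd.mdifferentiableAt hy)
    have h3 : (ψ ∘ π) =ᶠ[nhds y.1] (P ∘ φ) := by
      filter_upwards [φ.open_source.mem_nhds hy] with z hz using hloc z hz
    rw [h3.mfderiv_eq, h2] at h1
    have h4 := hφd.comp_symm_deriv (φ.map_source hy)
    rw [φ.left_inv hy] at h4
    have h5 := DFunLike.congr_fun h1 (mfderiv 𝓘(ℂ, Cn n) 𝓘(ℂ, Cn n) φ.symm (φ y.1) (R (w y)))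
    have h6 := DFunLike.congr_fun h4 (R (w y))
    refine h5.symm.trans ?_
    change mfderiv 𝓘(ℂ, Cn n) 𝓘(ℂ, Cn m) P (φ y.1) (mfderiv 𝓘(ℂ, Cn n) 𝓘(ℂ, Cn n) φ y.1
      (mfderiv 𝓘(ℂ, Cn n) 𝓘(ℂ, Cn n) φ.symm (φ y.1) (R (w y)))) = w y
    refine (congrArg _ h6).trans ?_
    rw [P.mfderiv_eq]
    exact hPR (w y)

lemma epi_differential (hπ : IsSmoothMorphism n m π) : Epi (differential hπ) := by
  refine epi_of_local_preimage _ fun U t x hx => ?_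
  let t' : (alongSheaf hπ.contMDiff).sec U := t
  obtain ⟨V, hxV, hV, v, hv, h⟩ := exists_local_lift hπ t'.1 t'.2 hx
  exact ⟨V, hxV, hV, (⟨v, hv⟩ : (alongSheaf (contMDiff_id (M := X))).sec V),
    Subtype.ext (funext h)⟩

end Submersions

/-! ### Positive rank and annihilators. -/

section Rank

variable {n : ℕ} {X : Type u} [TopologicalSpace X] [ChartedSpace (Cn n) X]

/-- A holomorphic function annihilating all local sections of a sheaf of positive rank vanishes. -/
lemma hol_apply_eq_zero_of_smul_eq_zero {M : OMod n X} {U : Opens X} (f : Hol n X U) (x : U)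
    (hM : rankAt M x.1 ≠ 0)
    (hf : ∀ (V : Opens X) (h : V ≤ U) (β : Sec M V), Hol.res n h f • β = 0) : f.1 x = 0 := by
  have h0 : ¬ Module.rank ((structureSheaf n X).presheaf.stalk x.1) (Stalk M x.1) = 0 :=
    fun h => hM (by rw [rankAt, Module.finrank, h, map_zero])
  rw [rank_eq_zero_iff] at h0
  push Not at h0
  -- Nonzero rank provides a germ `b` that no nonzero germ of a function kills. The germ of `f`
  -- kills it, hence is zero.
  obtain ⟨b, hb⟩ := h0
  obtain ⟨V, hxV, β, rfl⟩ := TopCat.Presheaf.exists_germ_eq (X := TopCat.of X) M.val.presheaf b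
  have h1 : (structureSheaf n X).presheaf.germ U x.1 x.2 f = 0 := by
    by_contra h
    refine hb _ h ?_
    have hβ : TopCat.Presheaf.germ (X := TopCat.of X) M.val.presheaf V x.1 hxV β =
        TopCat.Presheaf.germ (X := TopCat.of X) M.val.presheaf (U ⊓ V) x.1 ⟨x.2, hxV⟩
          (res M inf_le_right β) :=
      (TopCat.Presheaf.germ_res_apply (X := TopCat.of X) M.val.presheaf
        (homOfLE (inf_le_right : U ⊓ V ≤ V)) x.1 ⟨x.2, hxV⟩ β).symm
    have hg : (structureSheaf n X).presheaf.germ U x.1 x.2 f =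
        (structureSheaf n X).presheaf.germ (U ⊓ V) x.1 ⟨x.2, hxV⟩ (Hol.res n inf_le_left f) :=
      (TopCat.Presheaf.germ_res_apply (X := TopCat.of X) (structureSheaf n X).presheaf
        (homOfLE (inf_le_left : U ⊓ V ≤ U)) x.1 ⟨x.2, hxV⟩ f).symm
    rw [hβ, hg]
    refine (PresheafOfModules.germ_smul (X := TopCat.of X) (R := (structureSheaf n X).presheaf)
      M.val x.1 (U ⊓ V) ⟨x.2, hxV⟩ (Hol.res n inf_le_left f) (res M inf_le_right β)).symm.trans ?_
    exact (congrArg _ (hf (U ⊓ V) inf_le_left (res M inf_le_right β))).trans (map_zero _)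
  obtain ⟨W, hxW, i, j, hW⟩ := TopCat.Presheaf.germ_eq (X := TopCat.of X)
    (structureSheaf n X).presheaf x.1 x.2 x.2 f 0 (h1.trans (map_zero _).symm)
  exact congrArg (fun g : Hol n X W => g.1 ⟨x.1, hxW⟩) hW

end Rank

/-! ### Derivatives of functions pulled back from the base. -/

section Pullback

variable {n m : ℕ} {X S : Type u}
  [TopologicalSpace X] [ChartedSpace (Cn n) X] [IsManifold 𝓘(ℂ, Cn n) ω X]
  [TopologicalSpace S] [ChartedSpace (Cn m) S] [IsManifold 𝓘(ℂ, Cn m) ω S] {π : X → S}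

/-- The holomorphic function `h ∘ π`. -/
def Hol.pullback (hπ : IsSmoothMorphism n m π) {W : Opens S} {V : Opens X}
    (hVW : ∀ y ∈ V, π y ∈ W) (h : Hol m S W) : Hol n X V :=
  ⟨fun y => h.1 ⟨π y.1, hVW y.1 y.2⟩, by
    refine ContMDiff.comp (I' := 𝓘(ℂ, Cn m)) (g := h.1) h.2 ?_
    rw [← contMDiff_opens_iff]
    exact hπ.contMDiff.comp contMDiff_subtype_val⟩

/-- This is the chain rule: the derivative of $h\circ\pi$ along $v$ sees only $d\pi(v)$. The zero
extensions need to agree only near the point. -/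
lemma derivAlong_pullback_apply (hπ : IsSmoothMorphism n m π) {W : Opens S} {V : Opens X}
    (hVW : ∀ y ∈ V, π y ∈ W) (h : Hol m S W) (v : Sec (tangentSheaf n X) V) (y : V) :
    (derivAlong v (h.pullback hπ hVW)).1 y = mfderiv 𝓘(ℂ, Cn m) 𝓘(ℂ, ℂ) (extZero h.1) (π y.1)
      ((onSec (differential hπ) V v : (alongSheaf hπ.contMDiff).sec V).1 y) := by
  have hE : extZero (h.pullback hπ hVW).1 =ᶠ[nhds y.1] extZero h.1 ∘ π := by
    filter_upwards [V.isOpen.mem_nhds y.2] with z hz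
    rw [extZero_apply _ (⟨z, hz⟩ : V), Function.comp_apply,
      extZero_apply _ (⟨π z, hVW z hz⟩ : W)]
    rfl
  have h1 : MDifferentiableAt 𝓘(ℂ, Cn m) 𝓘(ℂ, ℂ) (extZero h.1) (π y.1) :=
    ((extZero_contMDiffOn h).contMDiffAt
      (W.isOpen.mem_nhds (hVW y.1 y.2))).mdifferentiableAt (by simp)
  have h2 : MDifferentiableAt 𝓘(ℂ, Cn n) 𝓘(ℂ, Cn m) π y.1 :=
    (hπ.contMDiff y.1).mdifferentiableAt (by simp)
  change mfderiv _ _ (extZero (h.pullback hπ hVW).1) y.1 _ = _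
  rw [hE.mfderiv_eq, mfderiv_comp y.1 h1 h2]
  rfl

lemma derivAlong_pullback_of_differential_eq_zero (hπ : IsSmoothMorphism n m π) {W : Opens S}
    {V : Opens X} (hVW : ∀ y ∈ V, π y ∈ W) (h : Hol m S W) (v : Sec (tangentSheaf n X) V)
    (hv : onSec (differential hπ) V v = 0) : derivAlong v (h.pullback hπ hVW) = 0 :=
  Subtype.ext (funext fun y => by
    rw [derivAlong_pullback_apply, hv]
    exact map_zero (mfderiv 𝓘(ℂ, Cn m) 𝓘(ℂ, ℂ) (extZero h.1) (π y.1)))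

lemma derivAlong_pullback_of_basic (hπ : IsSmoothMorphism n m π) {W : Opens S}
    {V : Opens X} (hVW : ∀ y ∈ V, π y ∈ W) (h : Hol m S W) (v : Sec (tangentSheaf n X) V)
    (Z : Sec (tangentSheaf m S) W)
    (hv : ∀ y : V, (onSec (differential hπ) V v : (alongSheaf hπ.contMDiff).sec V).1 y =
      (Z : (alongSheaf (contMDiff_id (M := S))).sec W).1 ⟨π y.1, hVW y.1 y.2⟩) :
    derivAlong v (h.pullback hπ hVW) = (derivAlong Z h).pullback hπ hVW :=
  Subtype.ext (funext fun y => by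
    rw [derivAlong_pullback_apply, hv]
    rfl)

/-- The coordinate functions of the preferred chart at `s`. -/
def coordFun (s : S) (i : Fin m) :
    Hol m S ⟨(chartAt (Cn m) s).source, (chartAt (Cn m) s).open_source⟩ :=
  ⟨fun y => (chartAt (Cn m) s y.1 : Cn m) i,
    (EuclideanSpace.proj i : Cn m →L[ℂ] ℂ).contMDiff.comp
      (contMDiffOn_chart.comp_contMDiff contMDiff_subtype_val fun y => y.2)⟩

/-- The derivative of a chart is injective, and its components are the derivatives of the coordinate
functions. -/
lemma eq_zero_of_mfderiv_coordFun_eq_zero (s : S) (z : TangentSpace 𝓘(ℂ, Cn m) s)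
    (h : ∀ i, mfderiv 𝓘(ℂ, Cn m) 𝓘(ℂ, ℂ) (extZero (coordFun (m := m) s i).1) s z = 0) : z = 0 := by
  have hc := mdifferentiable_chart (I := 𝓘(ℂ, Cn m)) s
  have hs := mem_chart_source (Cn m) s
  refine hc.mfderiv_injective hs ?_
  rw [map_zero]
  refine PiLp.ext fun i => ?_
  have hE : extZero (coordFun (m := m) s i).1 =ᶠ[nhds s]
      (EuclideanSpace.proj i : Cn m →L[ℂ] ℂ) ∘ chartAt (Cn m) s := by
    filter_upwards [(chartAt (Cn m) s).open_source.mem_nhds hs] with y hy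
    exact extZero_apply _ (⟨y, hy⟩ : (⟨_, (chartAt (Cn m) s).open_source⟩ : Opens S))
  have h1 := h i
  rw [hE.mfderiv_eq, mfderiv_comp s (ContinuousLinearMap.mdifferentiableAt _)
    (hc.mdifferentiableAt hs), ContinuousLinearMap.mfderiv_eq] at h1
  exact h1

end Pullback

/-! ### Brackets with projectable sections. -/

section Normalizer

variable {n m : ℕ} {X S : Type u}
  [TopologicalSpace X] [ChartedSpace (Cn n) X] [IsManifold 𝓘(ℂ, Cn n) ω X]
  [TopologicalSpace S] [ChartedSpace (Cn m) S] [IsManifold 𝓘(ℂ, Cn m) ω S] {π : X → S}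

/-- By the Jacobi identity, `a({u, v})(g) = a(u)(a(v)(g)) - a(v)(a(u)(g))` on sections of `M`; here
in a case in which the right-hand side vanishes. -/
lemma LieStructure.derivAlong_anchor_bracket_smul {M : OMod n X} {a : M ⟶ tangentSheaf n X}
    (L : LieStructure M a) {U : Opens X} (u v : Sec M U) (g : Hol n X U)
    (h1 : derivAlong (onSec a U u) g = 0)
    (h2 : derivAlong (onSec a U u) (derivAlong (onSec a U v) g) = 0) (β : Sec M U) :
    derivAlong (onSec a U (L.bracket U u v)) g • β = 0 := by
  -- After Leibniz, the terms $a(v)(g)\{u,\beta\}$ on the two sides cancel, and those with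
  -- coefficient $g$ cancel by the Jacobi identity for $u,v,\beta$. Only the asserted term remains.
  have h := L.jacobi' u v (g • β)
  simp only [L.leibniz', map_add, h1, h2, zero_smul, add_zero] at h
  rw [L.jacobi' u v β, smul_add] at h
  have h' := sub_eq_zero.2 h
  rw [← neg_eq_zero, ← h']
  abel

namespace Unfolding

variable {hπ : IsSmoothMorphism n m π} {AS : LieFamily hπ} (A : Unfolding AS)

/-- If `s` is projectable, the anchor of `{α, s}` is tangent to the fibres for `α` in `A_S`. -/
lemma differential_anchor_bracket_eq_zero {V : Opens X} (Z : AbSec (basicSheaf m π) V)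
    (s : Sec A.sheaf V) (hs : onSec (A.anchor ≫ differential hπ) V s = onAbSec (basicIncl hπ) V Z)
    (α : Sec AS.sheaf V) :
    onSec (A.anchor ≫ differential hπ) V (A.lie.bracket V (onSec A.incl V α) s) = 0 := by
  refine Subtype.ext (funext fun x => ?_)
  obtain ⟨V₁, hx, hV₁, W₁, hVW, Z₁, hZ₁, hZ⟩ := (Z : (basicFib m π).sec V).2 x
  let W₀ : Opens S := ⟨(chartAt (Cn m) (π x.1)).source, (chartAt (Cn m) (π x.1)).open_source⟩
  refine eq_zero_of_mfderiv_coordFun_eq_zero (π x.1) _ fun i => ?_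
  -- On `V₂` the field `Z` comes from the base and the chart coordinates at $\pi(x)$ are defined, so
  -- the `i`-th coordinate can serve as test function $h$.
  let V₂ : Opens X := V₁ ⊓ ⟨π ⁻¹' W₀, W₀.isOpen.preimage hπ.contMDiff.continuous⟩
  have hxV₂ : x.1 ∈ V₂ := ⟨hx, mem_chart_source (Cn m) (π x.1)⟩
  have hV₂ : V₂ ≤ V := inf_le_left.trans hV₁
  let h : Hol m S (W₁ ⊓ W₀) := Hol.res m inf_le_right (coordFun (π x.1) i)
  have hVW₂ : ∀ y ∈ V₂, π y ∈ W₁ ⊓ W₀ := fun y hy => ⟨hVW y hy.1, hy.2⟩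
  let g : Hol n X V₂ := h.pullback hπ hVW₂
  let Z₂ : Sec (tangentSheaf m S) (W₁ ⊓ W₀) :=
    (⟨fun y => Z₁ ⟨y.1, y.2.1⟩, hZ₁.restrict inf_le_left⟩ :
      (alongSheaf (contMDiff_id (M := S))).sec (W₁ ⊓ W₀))
  let u : Sec A.sheaf V₂ := onSec A.incl V₂ (res AS.sheaf hV₂ α)
  let s₂ : Sec A.sheaf V₂ := res A.sheaf hV₂ s
  -- Arbitrary `k` is needed: the vanishing is used for $h$ itself and again for $Z(h)$.
  have hu (k : Hol m S (W₁ ⊓ W₀)) :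
      derivAlong (onSec A.anchor V₂ u) (k.pullback hπ hVW₂) = 0 :=
    derivAlong_pullback_of_differential_eq_zero hπ hVW₂ k _
      (onSec_congr A.incl_anchor_differential V₂ (res AS.sheaf hV₂ α))
  have hs₂ : derivAlong (onSec A.anchor V₂ s₂) g = (derivAlong Z₂ h).pullback hπ hVW₂ := by
    refine derivAlong_pullback_of_basic hπ hVW₂ h _ Z₂ fun y => ?_
    have h1 : onSec (differential hπ) V₂ (onSec A.anchor V₂ s₂) =
        res (pullbackTangent hπ) hV₂ (onAbSec (basicIncl hπ) V Z) := by
      rw [← hs, ← onSec_res]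
      rfl
    rw [h1]
    exact hZ ⟨y.1, y.2.1⟩
  have hw : onSec A.anchor V₂ (A.lie.bracket V₂ u s₂) = res (tangentSheaf n X) hV₂
      (onSec A.anchor V (A.lie.bracket V (onSec A.incl V α) s)) := by
    rw [← onSec_res, ← A.lie.bracket_res, ← onSec_res]
  have hzero : (derivAlong (onSec A.anchor V₂ (A.lie.bracket V₂ u s₂)) g).1 ⟨x.1, hxV₂⟩ = 0 := by
    refine hol_apply_eq_zero_of_smul_eq_zero (M := A.sheaf) _ _ ?_ fun V₃ hV₃ β => ?_
    -- The index `i : Fin m` forces `m > 0`, so the rank of $\mathcal A$ is positive; for `m = 0`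
    -- there is no coordinate to test.
    · rw [A.rank_eq]
      have := i.pos
      omega
    · rw [← derivAlong_res, ← onSec_res, ← A.lie.bracket_res]
      refine A.lie.derivAlong_anchor_bracket_smul _ _ _ ?_ ?_ β
      · rw [onSec_res, derivAlong_res, hu, map_zero]
      · rw [onSec_res, onSec_res, derivAlong_res, hs₂, derivAlong_res, hu, map_zero]
  rw [derivAlong_pullback_apply, hw] at hzero
  have hE : extZero h.1 =ᶠ[nhds (π x.1)] extZero (coordFun (m := m) (π x.1) i).1 := by
    filter_upwards [(W₁ ⊓ W₀).isOpen.mem_nhds (hVW₂ x.1 hxV₂)] with y hy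
    rw [extZero_apply _ (⟨y, hy⟩ : (W₁ ⊓ W₀ : Opens S)), extZero_apply _ (⟨y, hy.2⟩ : W₀)]
    rfl
  rw [hE.mfderiv_eq] at hzero
  exact hzero

end Unfolding

end Normalizer

/-! ### The derivations $\{s,-\}$ and their descent to basic vector fields. -/

section Descent

variable {n m : ℕ} {X S : Type u}
  [TopologicalSpace X] [ChartedSpace (Cn n) X] [IsManifold 𝓘(ℂ, Cn n) ω X]
  [TopologicalSpace S] [ChartedSpace (Cn m) S] [IsManifold 𝓘(ℂ, Cn m) ω S] {π : X → S}

omit [IsManifold 𝓘(ℂ, Cn n) ω X] in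
-- Basic vector fields form only a sheaf of abelian groups, so the descent takes place there, and
-- surjectivity must be carried over from modules by its local form.
lemma epi_abMap {M N : OMod n X} (φ : M ⟶ N) [Epi φ] : Epi (abMap φ) := by
  refine (TopCat.Sheaf.isLocallySurjective_iff_epi (X := TopCat.of X) (abMap φ)).1 ?_
  rw [TopCat.Presheaf.isLocallySurjective_iff]
  intro U t x hx
  obtain ⟨V, hxV, hV, s, hs⟩ := exists_local_preimage_of_epi φ t hx
  exact ⟨V, hV, ⟨s, hs⟩, hxV⟩

omit [ChartedSpace (Cn n) X] [IsManifold 𝓘(ℂ, Cn n) ω X] in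
lemma exists_pullback_section {F G H : TopCat.Sheaf AddCommGrpCat.{u} (TopCat.of X)} (f : F ⟶ H)
    (g : G ⟶ H) (U : Opens X) (s : AbSec F U) (t : AbSec G U) (h : onAbSec f U s = onAbSec g U t) :
    ∃ p : AbSec (pullback f g) U,
      onAbSec (pullback.fst f g) U p = s ∧ onAbSec (pullback.snd f g) U p = t := by
  have h1 := (IsPullback.of_hasPullback f g).map
    (sheafToPresheaf _ _ ⋙ (evaluation _ _).obj (op U) ⋙ forget AddCommGrpCat.{u})
  obtain ⟨p, h2, h3⟩ := Types.exists_of_isPullback h1 s t h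
  exact ⟨p, h2, h3⟩

omit [ChartedSpace (Cn n) X] [IsManifold 𝓘(ℂ, Cn n) ω X] in
lemma hom_ext_onAbSec {F G : TopCat.Sheaf AddCommGrpCat.{u} (TopCat.of X)} {f g : F ⟶ G}
    (h : ∀ (U : Opens X) (s : AbSec F U), onAbSec f U s = onAbSec g U s) : f = g :=
  CategoryTheory.Sheaf.hom_ext (NatTrans.ext (funext fun U => AddCommGrpCat.hom_ext (AddMonoidHom.ext
    fun s => h U.unop s)))

namespace Unfolding

variable {hπ : IsSmoothMorphism n m π} {AS : LieFamily hπ} (A : Unfolding AS)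

/-- A section of `A` normalizes `A_S`. -/
def Normalizes {V : Opens X} (s : Sec A.sheaf V) : Prop :=
  ∀ (W : Opens X) (hW : W ≤ V) (α : Sec AS.sheaf W),
    A.lie.bracket W (res A.sheaf hW s) (onSec A.incl W α) ∈ Set.range (onSec A.incl W)

variable {A}

/-- The operator `{s, -}` on `A_S`, for a section `s` of `A` normalizing `A_S`. -/
def Normalizes.op {V : Opens X} {s : Sec A.sheaf V} (hs : A.Normalizes s) (W : Opens X)
    (hW : W ≤ V) : Sec AS.sheaf W →+ Sec AS.sheaf W :=
  -- The chosen preimage is the only one, since $\mathcal A_S\to\mathcal A$ is injective on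
  -- sections; this gives additivity.
  AddMonoidHom.mk' (fun α => Classical.choose (hs W hW α)) fun α β => A.incl_injective W (by
    refine (Classical.choose_spec (hs W hW (α + β))).trans ?_
    rw [map_add, map_add, map_add]
    exact (congrArg₂ (· + ·) (Classical.choose_spec (hs W hW α))
      (Classical.choose_spec (hs W hW β))).symm)

lemma Normalizes.onSec_incl_op {V : Opens X} {s : Sec A.sheaf V} (hs : A.Normalizes s)
    (W : Opens X) (hW : W ≤ V) (α : Sec AS.sheaf W) :
    onSec A.incl W (hs.op W hW α) = A.lie.bracket W (res A.sheaf hW s) (onSec A.incl W α) :=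
  Classical.choose_spec (hs W hW α)

/-- The derivation `{s, -}` of `A_S`, for a section `s` of `A` normalizing `A_S`. -/
def Normalizes.der {V : Opens X} {s : Sec A.sheaf V} (hs : A.Normalizes s) : AS.lie.lieDer V :=
  ⟨(fun W => hs.op W.1 W.2, onSec A.anchor V s),
    { op_res := fun W W' h α => A.incl_injective W'.1 (by
        rw [hs.onSec_incl_op, onSec_res, onSec_res, hs.onSec_incl_op, ← A.lie.bracket_res,
          pres_pres])
      op_bracket := fun W α β => A.incl_injective W.1 (by
        rw [hs.onSec_incl_op, map_add, A.incl_bracket, A.incl_bracket, A.incl_bracket,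
          hs.onSec_incl_op, hs.onSec_incl_op, A.lie.jacobi'])
      op_smul := fun W f α => A.incl_injective W.1 (by
        rw [hs.onSec_incl_op, map_add, (onSec A.incl W.1).map_smul, (onSec A.incl W.1).map_smul,
          (onSec A.incl W.1).map_smul, hs.onSec_incl_op, A.lie.leibniz', onSec_res]) }⟩

/-- The equation is a hypothesis so that `r` may be the section attached to a sum of pairs, rather
than a literal sum. -/
lemma Normalizes.der_eq_add {V : Opens X} {r s t : Sec A.sheaf V} (hr : A.Normalizes r)
    (hs : A.Normalizes s) (ht : A.Normalizes t) (h : r = s + t) : hr.der = hs.der + ht.der :=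
  AS.lie.lieDer_ext (fun W hW α => A.incl_injective W (by
    change onSec A.incl W (hr.op W hW α) = onSec A.incl W (hs.op W hW α + ht.op W hW α)
    rw [map_add, hr.onSec_incl_op, hs.onSec_incl_op, ht.onSec_incl_op, h, map_add, map_add,
      AddMonoidHom.add_apply])) (by
    change onSec A.anchor V r = onSec A.anchor V s + onSec A.anchor V t
    rw [h, map_add])

lemma Normalizes.der_eq_res {U V : Opens X} (hV : V ≤ U) {r : Sec A.sheaf V} {s : Sec A.sheaf U}
    (hr : A.Normalizes r) (hs : A.Normalizes s) (h : r = res A.sheaf hV s) :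
    hr.der = AS.lie.lieDerRes hV hs.der :=
  AS.lie.lieDer_ext (fun W hW α => A.incl_injective W (by
    change onSec A.incl W (hr.op W hW α) = onSec A.incl W (hs.op W (hW.trans hV) α)
    rw [hr.onSec_incl_op, hs.onSec_incl_op, h, pres_pres])) (by
    change onSec A.anchor V r = res (tangentSheaf n X) hV (onSec A.anchor U s)
    rw [h, onSec_res])

/-- Sections coming from $\mathcal A_S$ act by inner derivations; this is why the class of $\{s,-\}$
does not depend on the lift `s`. -/
lemma Normalizes.der_eq_adSec {V : Opens X} {s : Sec A.sheaf V} (hs : A.Normalizes s)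
    {α : Sec AS.sheaf V} (h : onSec A.incl V α = s) : hs.der = AS.lie.adSec α :=
  AS.lie.lieDer_ext (fun W hW β => A.incl_injective W (by
    change onSec A.incl W (hs.op W hW β) =
      onSec A.incl W (AS.lie.bracket W (res AS.sheaf hW α) β)
    rw [hs.onSec_incl_op, A.incl_bracket, onSec_res, h])) (by
    change onSec A.anchor V s = _
    rw [← h]
    exact A.onSec_anchor_onSec_incl α)

variable (A) in
/-- The sections of `A` whose anchor is projectable normalize `A_S`. -/
lemma IsTransversal.normalizes (hA : A.IsTransversal) {V : Opens X} (Z : AbSec (basicSheaf m π) V)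
    (s : Sec A.sheaf V)
    (hs : onSec (A.anchor ≫ differential hπ) V s = onAbSec (basicIncl hπ) V Z) :
    A.Normalizes s := by
  intro W hW α
  have h : onSec (A.anchor ≫ differential hπ) W (res A.sheaf hW s) = onAbSec (basicIncl hπ) W
      ((basicSheaf m π).obj.map (homOfLE hW).op Z) := by
    rw [onSec_res, hs]
    rfl
  -- Membership in $\mathcal A_S$ becomes verticality of the anchor, which is the vanishing already
  -- proved for $\{\alpha,s\}$.
  rw [A.lie.skew, hA.mem_range_incl_iff, map_neg,
    A.differential_anchor_bracket_eq_zero _ _ h, neg_zero]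

/-- The sheaf of pairs `(s, Z)` of a section of `A` and a basic vector field with the same class in
`A / A_S`. -/
def liftSheaf (υ : pullbackTangent hπ ⟶ cokernel A.incl) :
    TopCat.Sheaf AddCommGrpCat.{u} (TopCat.of X) :=
  pullback (abMap (cokernel.π A.incl)) (basicIncl hπ ≫ abMap υ)

/-- The section `s` of a pair `(s, Z)`. -/
def liftFst (υ : pullbackTangent hπ ⟶ cokernel A.incl) : liftSheaf υ ⟶ ab A.sheaf :=
  pullback.fst _ _

/-- The basic vector field `Z` of a pair `(s, Z)`. -/
def liftSnd (υ : pullbackTangent hπ ⟶ cokernel A.incl) : liftSheaf υ ⟶ basicSheaf m π :=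
  pullback.snd _ _

/-- The map is a base change of the epimorphism $\mathcal A\to\mathcal A/\mathcal A_S$, and
epimorphisms are stable under base change in an abelian category. It expresses that every basic
field lifts locally. -/
instance (υ : pullbackTangent hπ ⟶ cokernel A.incl) : Epi (liftSnd υ) := by
  have := epi_abMap (cokernel.π A.incl)
  exact Abelian.epi_pullback_of_epi_f _ _

/-- Apply $[a]$ to the class of `s`: since `υ` is a section of $[a]$, the result is `Z`. -/
lemma onSec_differential_of_lift {υ : pullbackTangent hπ ⟶ cokernel A.incl}
    (hυ : υ ≫ A.anchorQuot = 𝟙 _) {V : Opens X} {Z : AbSec (basicSheaf m π) V}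
    {s : Sec A.sheaf V}
    (hs : onSec (cokernel.π A.incl) V s = onAbSec (basicIncl hπ ≫ abMap υ) V Z) :
    onSec (A.anchor ≫ differential hπ) V s = onAbSec (basicIncl hπ) V Z := by
  have h : cokernel.π A.incl ≫ A.anchorQuot = A.anchor ≫ differential hπ := cokernel.π_desc _ _ _
  rw [← h, onSec_comp, hs]
  exact onSec_congr hυ V (onAbSec (basicIncl hπ) V Z)

/-- The section `s` of a pair `(s, Z)`. -/
def liftSec (υ : pullbackTangent hπ ⟶ cokernel A.incl) (V : Opens X) :
    AbSec (liftSheaf υ) V →+ Sec A.sheaf V :=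
  onAbSec (liftFst υ) V

lemma liftSec_res (υ : pullbackTangent hπ ⟶ cokernel A.incl) {U V : Opens X} (h : V ≤ U)
    (p : AbSec (liftSheaf υ) U) :
    liftSec υ V ((liftSheaf υ).presheaf.map (homOfLE h).op p) = res A.sheaf h (liftSec υ U p) :=
  congrArg (fun f => f.hom p) ((liftFst υ).hom.naturality (homOfLE h).op)

lemma onSec_liftSec (υ : pullbackTangent hπ ⟶ cokernel A.incl) {V : Opens X}
    (p : AbSec (liftSheaf υ) V) :
    onSec (cokernel.π A.incl) V (liftSec υ V p) =
      onAbSec (basicIncl hπ ≫ abMap υ) V (onAbSec (liftSnd υ) V p) :=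
  congrArg (fun f => onAbSec f V p) (pullback.condition
    (f := abMap (cokernel.π A.incl)) (g := basicIncl hπ ≫ abMap υ))

section

variable (hA : A.IsTransversal) {υ : pullbackTangent hπ ⟶ cokernel A.incl}
  (hυ : υ ≫ A.anchorQuot = 𝟙 _)

include hA hυ in
lemma normalizes_liftSec {V : Opens X} (p : AbSec (liftSheaf υ) V) :
    A.Normalizes (liftSec υ V p) :=
  IsTransversal.normalizes A hA _ _ (onSec_differential_of_lift hυ (onSec_liftSec υ p))

/-- The morphism `(s, Z) ↦ {s, -}`. -/
def liftDer : liftSheaf υ ⟶ AS.lie.lieDerSheaf where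
  hom :=
    { app U := AddCommGrpCat.ofHom
        (AddMonoidHom.mk' (fun p : AbSec (liftSheaf υ) U.unop => (normalizes_liftSec hA hυ p).der)
          (fun p q => Normalizes.der_eq_add _ _ _ (map_add (liftSec υ U.unop) p q)) :
          AbSec (liftSheaf υ) U.unop →+ AS.lie.lieDer U.unop)
      naturality _ _ i := AddCommGrpCat.hom_ext (AddMonoidHom.ext fun p =>
        Normalizes.der_eq_res i.unop.le _ _ (liftSec_res υ i.unop.le p)) }

/-- A pair with $Z=0$ has $s\in\mathcal A_S$, so its derivation is inner and vanishes in the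
quotient. -/
lemma kernel_liftSnd_liftDer :
    kernel.ι (liftSnd υ) ≫ liftDer hA hυ ≫ cokernel.π AS.lie.ad = 0 := by
  refine hom_ext_onAbSec fun U k => ?_
  let p : AbSec (liftSheaf υ) U := onAbSec (kernel.ι (liftSnd υ)) U k
  have hp : onAbSec (liftSnd υ) U p = 0 :=
    congrArg (fun f => onAbSec f U k) (kernel.condition (liftSnd υ))
  have h1 := onSec_liftSec υ p
  rw [hp, map_zero] at h1
  obtain ⟨α, hα⟩ := (hA.mem_range_incl_iff_cokernel _).2 h1
  have h2 : onAbSec (liftDer hA hυ) U p = onAbSec AS.lie.ad U α :=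
    (normalizes_liftSec hA hυ p).der_eq_adSec hα
  have h3 : onAbSec (cokernel.π AS.lie.ad) U (onAbSec AS.lie.ad U α) = 0 :=
    congrArg (fun f => onAbSec f U α) (cokernel.condition AS.lie.ad)
  exact (congrArg (onAbSec (cokernel.π AS.lie.ad) U) h2).trans h3

/-- The map `π⁻¹T_S → (Der_Lie(A_S) ∩ D^{≤1}(A_S)) / A_S`, `Z ↦ [{s, -}]` for `s` lifting `υ(Z)`. -/
def basicToQuot : basicSheaf m π ⟶ cokernel AS.lie.ad :=
  Abelian.epiDesc (liftSnd υ) (liftDer hA hυ ≫ cokernel.π AS.lie.ad)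
    (kernel_liftSnd_liftDer hA hυ)

lemma liftSnd_basicToQuot :
    liftSnd υ ≫ basicToQuot hA hυ = liftDer hA hυ ≫ cokernel.π AS.lie.ad :=
  Abelian.comp_epiDesc _ _ _

/-- After composition with the epimorphism from pairs, this says that the symbol $a(s)$ of $\{s,-\}$
projects to `Z`. -/
lemma basicToQuot_quotSymbol : basicToQuot hA hυ ≫ AS.quotSymbol = basicIncl hπ := by
  rw [← cancel_epi (liftSnd υ), ← Category.assoc, liftSnd_basicToQuot, Category.assoc]
  have h : cokernel.π AS.lie.ad ≫ AS.quotSymbol =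
      AS.lie.symbolMap ≫ abMap (differential hπ) := cokernel.π_desc _ _ _
  rw [h]
  exact hom_ext_onAbSec fun U p => onSec_differential_of_lift hυ (onSec_liftSec υ p)

end

end Unfolding

end Descent

end

end HolAlgebroid

/-! ### The proposition. -/

theorem mainTheorem5 {n m : ℕ} {X S : Type u}
    [TopologicalSpace X] [ChartedSpace (Cn n) X]
    [IsManifold 𝓘(ℂ, Cn n) ω X]
    [TopologicalSpace S] [ChartedSpace (Cn m) S]
    [IsManifold 𝓘(ℂ, Cn m) ω S]
    {π : X → S} (hπ : IsSmoothMorphism n m π)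
    (AS : LieFamily hπ) (A : Unfolding AS) (hA : A.IsTransversal) :
    ∃ υ : pullbackTangent hπ ⟶ cokernel A.incl,
      (A.anchorQuot ≫ υ = 𝟙 _ ∧ υ ≫ A.anchorQuot = 𝟙 _) ∧
      -- every lift to `A` of a section of `υ(π⁻¹T_S)` normalizes `A_S`
      (∀ (V : Opens X) (Z : AbSec (basicSheaf m π) V)
        (s : Sec A.sheaf V),
        onSec (cokernel.π A.incl) V s = onAbSec
          (basicIncl hπ ≫ abMap υ) V Z →
        ∀ (W : Opens X) (hW : W ≤ V) (α : Sec AS.sheaf W),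
          A.lie.bracket W (onSec A.incl W α) (res A.sheaf hW s) ∈
            Set.range (onSec A.incl W)) ∧
      -- so that `υ(π⁻¹T_S)` is a subsheaf of `𝔲(A_S)`
      ∃ j : basicSheaf m π ⟶ AS.frakU,
        Mono j ∧ j ≫ AS.frakUSymbol = 𝟙 _ ∧
        ∀ (V : Opens X) (Z : AbSec (basicSheaf m π) V)
          (s : Sec A.sheaf V),
          onSec (cokernel.π A.incl) V s = onAbSec
            (basicIncl hπ ≫ abMap υ) V Z →
          ∃ δ : AS.lie.lieDer V,
            δ.1.2 = onSec A.anchor V s ∧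
            (∀ (W : Opens X) (hW : W ≤ V) (α : Sec AS.sheaf W),
              onSec A.incl W (δ.1.1 ⟨W, hW⟩ α) =
                A.lie.bracket W (res A.sheaf hW s)
                  (onSec A.incl W α)) ∧
            onAbSec (j ≫ AS.frakUIncl) V Z =
              onAbSec (cokernel.π AS.lie.ad) V δ := by
  have := epi_differential hπ
  have := hA.isIso_anchorQuot
  let υ := inv A.anchorQuot
  have hυ : υ ≫ A.anchorQuot = 𝟙 _ := IsIso.inv_hom_id _
  have hn (V : Opens X) (Z : AbSec (basicSheaf m π) V) (s : Sec A.sheaf V)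
      (hs : onSec (cokernel.π A.incl) V s = onAbSec (basicIncl hπ ≫ abMap υ) V Z) :
      A.Normalizes s :=
    Unfolding.IsTransversal.normalizes A hA Z s (Unfolding.onSec_differential_of_lift hυ hs)
  refine ⟨υ, ⟨IsIso.hom_inv_id _, hυ⟩, fun V Z s hs W hW α => ?_, ?_⟩
  · obtain ⟨β, hβ⟩ := hn V Z s hs W hW α
    rw [A.lie.skew, ← hβ, ← map_neg]
    exact ⟨_, rfl⟩
  -- Since $\mathfrak u(\mathcal A_S)$ is a fibre product, the class of $\{s,-\}$ and the identity
  -- of $\pi^{-1}T_S$ define `j`. Being split by the symbol, it is a monomorphism.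
  · let j : basicSheaf m π ⟶ AS.frakU := pullback.lift (Unfolding.basicToQuot hA hυ) (𝟙 _)
      ((Unfolding.basicToQuot_quotSymbol hA hυ).trans (Category.id_comp _).symm)
    have hj : j ≫ AS.frakUSymbol = 𝟙 _ := pullback.lift_snd _ _ _
    have hj' : j ≫ AS.frakUIncl = Unfolding.basicToQuot hA hυ := pullback.lift_fst _ _ _
    have hmono : Mono (j ≫ AS.frakUSymbol) := by
      rw [hj]
      infer_instance
    refine ⟨j, mono_of_mono j AS.frakUSymbol, hj, fun V Z s hs => ?_⟩
    refine ⟨(hn V Z s hs).der, rfl, (hn V Z s hs).onSec_incl_op, ?_⟩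
    -- Any given lift `s` of `Z` is a component of a section `p` of the sheaf of pairs, so the
    -- defining equation of the descended map, evaluated at `p`, computes the class.
    obtain ⟨p, rfl, rfl⟩ := exists_pullback_section (abMap (cokernel.π A.incl))
      (basicIncl hπ ≫ abMap υ) V s Z hs
    rw [hj']
    exact congrArg (fun f => onAbSec f V p) (Unfolding.liftSnd_basicToQuot hA hυ)
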